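/- **Setting.** Let $n\ge 0$ and $[n]=\{1,\dots,n\}$. Vertices of the $n$-cube are the subsets of $[n]$, and $\oplus$ denotes symmetric difference (and exclusive or). An orientation of the $n$-cube is an outmap $o:2^{[n]}\to 2^{[n]}$ with $d\in o(v)\Leftrightarrow d\notin o(v\oplus\{d\})$ for all $v,d$. It is a unique sink orientation (USO) if for every $D\subseteq[n]$ and every vertex $v$ there is exactly one $w$ with $v\oplus w\subseteq D$ and $o(w)\cap D=\emptyset$. Let $G=([n],E)$ be a directed graph with a loop at every vertex and no other directed cycles. The Matoušek USO with dimension influence graph $G$ is the map $m:2^{[n]}\to2^{[n]}$ with $m(\emptyset)=\emptyset$ and $$\big(d'\in m(v)\big)\oplus\big(d'\in m(v\oplus\{d\})\big)\iff (d,d')\in E\qquad\text{for all } d,d'\in[n],\ v\subseteq[n].$$ Let $G_1$ be the graph on three vertices $x,y,z$ whose non-loop edges are $(x,y),(y,z)$, and $G_2$ the graph on three vertices $p_1,p_2,x$ whose non-loop edges are $(p_1,x),(p_2,x)$ (all loops present in both). A branching is a directed graph without directed cycles in which every vertex has at most one incoming edge (a disjoint union of arborescences). *P-LCP.* A P-matrix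 is a matrix $M\in\mathbb R^{n\times n}$ all of whose principal minors are positive. For $q\in\mathbb R^n$ and $B\subseteq[n]$, a candidate solution for $B$ is a pair $(w,z)$ with $w-Mz=q$, $w_i=0$ for $i\in B$ and $z_i=0$ for $i\notin B$. The instance $(M,q)$ is non-degenerate if $w_i=z_i=0$ never happens in a candidate solution. A non-degenerate P-LCP instance $(M,q)$ realizes $o$ if for every $B$, $o(B)=\{i: w_i\le 0 \text{ and } z_i\le 0\}$ for the (unique) candidate solution $(w,z)$ for $B$. An orientation is realizable if some non-degenerate P-LCP instance realizes it. *Matroids.* Oriented matroids are given by their circuits (signed sets). A matrix realizes the oriented matroid whose circuits are the sign vectors of the nonzero linear dependencies of its columns with inclusion-minimal support. The alternating matroid $\mathcal A^{k,r}$ on $\{1,\dots,k\}$ is realized by the matrix with columns $(1,x_j,\dots,x_j^{r-1})^T$, $x_1<\dots<x_k$. Let $E_{2n}=S\cup T$ with $S=\{1,\dots,n\}$, $T=\{n+1,\dots,2n\}$, and let $\bar e$ denote the complementary element ($i\leftrightarrow i+n$). An oriented matroid on $E_{2n}$ is a P-matroid if each $n$-element set without a complementary pair is a basis (an inclusion-maximal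 set containing no circuit) and in every circuit whose support contains exactly one complementary pair, the two elements of this pair have the same sign. It is a cyclic-P-matroid if in addition it becomes $\mathcal A^{2n,n}$ after changing the signs of some set of elements and relabeling the elements by a bijection with $\{1,\dots,2n\}$. A simple extension $\hat{\mathcal M}$ of a cyclic-P-matroid $\mathcal M$, with data $(\pi,F)$, is an oriented matroid on $\hat E_{2n}=E_{2n}\cup\{q\}$ such that - deleting $q$ from $\hat{\mathcal M}$ gives $\mathcal M$; - $\pi:\hat E_{2n}\to\{1,\dots,2n+1\}$ is a bijection, $F\subseteq\hat E_{2n}$, and flipping the signs of the elements of $F$ in all circuits of $\hat{\mathcal M}$ and then renaming each element $e$ to $\pi(e)$ gives $\mathcal A^{2n+1,n}$; - with $\pi'$ the ordering of $E_{2n}$ by $\{1,\dots,2n\}$ induced by $\pi$: whenever $\pi'(e)<\pi'(\bar e)$, the interval $[\pi'(e),\pi'(\bar e)]$ contains both or none of $\pi'(f),\pi'(\bar f)$, for all $f\in E_{2n}$; and for each $e\in E_{2n}$, exactly one of $e,\bar e$ is in $F$ if $(|\pi'(e)-\pi'(\bar e)|-1)/2$ is even, and both or none are in $F$ otherwise.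 The orientation $u$ associated with $\hat{\mathcal M}$ is given by: $i\in u(v)$ iff $i$ or $i+n$ is negative in the fundamental circuit with support $\{i:i\notin v\}\cup\{i+n:i\in v\}\cup\{q\}$ in which $q$ is positive. **Theorem.** Let $m$ be the Matoušek USO with dimension influence graph $G$. Then $m$ is a USO, and: 1. $m$ is realizable if and only if $G$ contains neither $G_1$ nor $G_2$ as an induced subgraph. 2. $G$ contains neither $G_1$ nor $G_2$ as an induced subgraph if and only if $G$ is the transitive closure of a branching (with a loop added at every vertex). 3. If $m$ is realizable, then there is a simple extension $\hat{\mathcal M}$ of a cyclic-P-matroid, with data $(\pi,F)$ such that $q$ is the last element of $\pi$ (that is, $\pi(q)=2n+1$), whose associated orientation is $m$. Moreover, for all reals $x_1<\dots<x_{2n+1}$, let $V\in\mathbb R^{n\times\hat E_{2n}}$ be the matrix whose column at $e$ is $\varepsilon_e\,(1,x_{\pi(e)},\dots,x_{\pi(e)}^{n-1})^T$, with $\varepsilon_e=-1$ if $e\in F$ and $\varepsilon_e=1$ otherwise. Then $V$ realizes $\hat{\mathcal M}$, the submatrix $V_S$ is invertible, and $$(M,q):=\big(-V_S^{-1}V_T,\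 -V_S^{-1}V_q\big)$$ is a non-degenerate P-LCP instance that realizes $m$, and $\begin{bmatrix} I_n & -M & -q\end{bmatrix}$ realizes $\hat{\mathcal M}$. -/

import Mathlib

open Matrix

/-! ### Orientations of the cube

Vertices of the `n`-cube are the finite sets `v : Finset (Fin n)`; an orientation is given by its
outmap `o : Finset (Fin n) → Finset (Fin n)`. The symmetric difference is `symmDiff`. -/

/-- `o` is an orientation of the cube: the edge in dimension `d` at `v` is outgoing at exactly one
of its two endpoints. -/
def IsOrientation {n : ℕ} (o : Finset (Fin n) → Finset (Fin n)) : Prop :=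
  ∀ (v : Finset (Fin n)) (d : Fin n), d ∈ o v ↔ d ∉ o (symmDiff v {d})

/-- `o` is a unique sink orientation: each face (the face through `v` spanned by the dimensions `D`
consists of the vertices `w` that differ from `v` only in dimensions of `D`) has a unique sink. -/
def IsUSO {n : ℕ} (o : Finset (Fin n) → Finset (Fin n)) : Prop :=
  IsOrientation o ∧
    ∀ D v : Finset (Fin n), ∃! w : Finset (Fin n), symmDiff v w ⊆ D ∧ o w ∩ D = ∅

/-- `G` has a loop at each vertex and no other directed cycles. -/
def IsInfluenceGraph {n : ℕ} (G : Digraph (Fin n)) : Prop :=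
  (∀ d, G.Adj d d) ∧
    ∀ d e, Relation.TransGen G.Adj d e → Relation.TransGen G.Adj e d → d = e

/-- `m` is the Matoušek orientation with dimension influence graph `G`: the empty set is the sink,
and walking along an edge of dimension `d` changes the outmap exactly in the dimensions `d'` that
are influenced by `d`. -/
def IsMatousek {n : ℕ} (G : Digraph (Fin n)) (m : Finset (Fin n) → Finset (Fin n)) : Prop :=
  IsInfluenceGraph G ∧ m ∅ = ∅ ∧
    ∀ (d d' : Fin n) (v : Finset (Fin n)),
      Xor (d' ∈ m v) (d' ∈ m (symmDiff v {d})) ↔ G.Adj d d'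

/-- The forbidden graph `G₁`: a directed path `0 → 1 → 2` without the edge `0 → 2`
(and with all loops). -/
def forbiddenG1 : Digraph (Fin 3) where
  Adj i j := i = j ∨ (i = 0 ∧ j = 1) ∨ (i = 1 ∧ j = 2)

/-- The forbidden graph `G₂`: the edges `0 → 2` and `1 → 2` (and all loops). -/
def forbiddenG2 : Digraph (Fin 3) where
  Adj i j := i = j ∨ (i = 0 ∧ j = 2) ∨ (i = 1 ∧ j = 2)

/-- `G` contains `H` as an induced subgraph. -/
def ContainsInduced {V W : Type*} (G : Digraph V) (H : Digraph W) : Prop :=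
  Nonempty (H.Adj ↪r G.Adj)

/-- A branching (a disjoint union of arborescences): each vertex has at most one parent and there
are no directed cycles (in particular no loops). -/
def IsBranching {V : Type*} (B : Digraph V) : Prop :=
  (∀ a b c, B.Adj a c → B.Adj b c → a = b) ∧ ∀ a, ¬ Relation.TransGen B.Adj a a

/-- `G` is the transitive closure of a branching, with a loop added at each vertex. -/
def IsClosureOfBranching {V : Type*} (G : Digraph V) : Prop :=
  ∃ B : Digraph V, IsBranching B ∧ ∀ a b, G.Adj a b ↔ Relation.ReflTransGen B.Adj a b

/-! ### The P-matrix linear complementarity problem -/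

/-- A P-matrix: all principal minors are positive. -/
def IsPMatrix {n : ℕ} (M : Matrix (Fin n) (Fin n) ℝ) : Prop :=
  ∀ s : Finset (Fin n), 0 < (M.submatrix (fun i : s => (i : Fin n)) (fun i : s => (i : Fin n))).det

/-- `(w, z)` is the candidate solution of `(M, q)` belonging to the set `B`. -/
def IsCandidate {n : ℕ} (M : Matrix (Fin n) (Fin n) ℝ) (q : Fin n → ℝ) (B : Finset (Fin n))
    (w z : Fin n → ℝ) : Prop :=
  w - M *ᵥ z = q ∧ (∀ i ∈ B, w i = 0) ∧ ∀ i ∉ B, z i = 0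

/-- `q` is non-degenerate for `M`: no candidate solution has a complementary pair of zeros. -/
def IsNondegenerate {n : ℕ} (M : Matrix (Fin n) (Fin n) ℝ) (q : Fin n → ℝ) : Prop :=
  ∀ (B : Finset (Fin n)) (w z : Fin n → ℝ), IsCandidate M q B w z →
    ∀ i, ¬ (w i = 0 ∧ z i = 0)

/-- `(M, q)` is a non-degenerate P-LCP instance realizing `o`: at the vertex `B`, the outmap
consists of the `i` with `w i, z i ≤ 0` in the (unique) candidate solution belonging to `B`. -/
def PLCPRealizes {n : ℕ} (M : Matrix (Fin n) (Fin n) ℝ) (q : Fin n → ℝ)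
    (o : Finset (Fin n) → Finset (Fin n)) : Prop :=
  IsPMatrix M ∧ IsNondegenerate M q ∧
    ∀ B : Finset (Fin n), ∃ w z : Fin n → ℝ, IsCandidate M q B w z ∧
      ∀ i, i ∈ o B ↔ w i ≤ 0 ∧ z i ≤ 0

/-- `o` is induced by some P-LCP instance. -/
def IsRealizable {n : ℕ} (o : Finset (Fin n) → Finset (Fin n)) : Prop :=
  ∃ (M : Matrix (Fin n) (Fin n) ℝ) (q : Fin n → ℝ), PLCPRealizes M q o

/-! ### Oriented matroids

A signed set on `E` is a function `X : E → SignType`, with `X⁺ = {e | X e = 1}` and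
`X⁻ = {e | X e = -1}`. -/

/-- An oriented matroid in circuit representation. -/
@[ext]
structure OrientedMatroid (E : Type*) where
  circuits : Set (E → SignType)
  zero_notMem : (0 : E → SignType) ∉ circuits
  neg_mem : ∀ X ∈ circuits, -X ∈ circuits
  incomparable : ∀ X ∈ circuits, ∀ Y ∈ circuits,
    Function.support X ⊆ Function.support Y → X = Y ∨ X = -Y
  elimination : ∀ X ∈ circuits, ∀ Y ∈ circuits, X ≠ -Y → ∀ e, X e = 1 → Y e = -1 →
    ∃ Z ∈ circuits, Z e = 0 ∧
      (∀ f, Z f = 1 → X f = 1 ∨ Y f = 1) ∧ (∀ f, Z f = -1 → X f = -1 ∨ Y f = -1)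

/-- The signed set `X` with the signs of all elements of `F` flipped. -/
def flipSigns {E : Type*} [DecidableEq E] (F : Finset E) (X : E → SignType) : E → SignType :=
  fun e => if e ∈ F then -X e else X e

theorem flipSigns_flipSigns {E : Type*} [DecidableEq E] (F : Finset E) (X : E → SignType) :
    flipSigns F (flipSigns F X) = X := by
  funext e
  by_cases h : e ∈ F <;> simp [flipSigns, h]

theorem flipSigns_neg {E : Type*} [DecidableEq E] (F : Finset E) (X : E → SignType) :
    flipSigns F (-X) = -flipSigns F X := by
  funext e
  by_cases h : e ∈ F <;> simp [flipSigns, h]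

theorem support_flipSigns {E : Type*} [DecidableEq E] (F : Finset E) (X : E → SignType) :
    Function.support (flipSigns F X) = Function.support X := by
  ext e
  by_cases h : e ∈ F <;> simp [flipSigns, h]

namespace OrientedMatroid

/-- The reorientation of `M` by `F`: the signs of the elements of `F` are flipped in all
circuits. -/
def reorient {E : Type*} [DecidableEq E] (M : OrientedMatroid E) (F : Finset E) :
    OrientedMatroid E where
  circuits := {X | flipSigns F X ∈ M.circuits}
  zero_notMem h := by
    have h0 : flipSigns F (0 : E → SignType) = 0 := by
      funext e
      simp [flipSigns]
    rw [Set.mem_ofPred_eq, h0] at h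
    exact M.zero_notMem h
  neg_mem X hX := by
    rw [Set.mem_ofPred_eq, flipSigns_neg]
    exact M.neg_mem _ hX
  incomparable X hX Y hY h := by
    have hinj := Function.LeftInverse.injective (flipSigns_flipSigns F)
    rcases M.incomparable _ hX _ hY (by simpa only [support_flipSigns] using h) with h' | h'
    · exact Or.inl (hinj h')
    · rw [← flipSigns_neg] at h'
      exact Or.inr (hinj h')
  elimination X hX Y hY hne e hXe hYe := by
    have hinj := Function.LeftInverse.injective (flipSigns_flipSigns F)
    have hne' : flipSigns F X ≠ -flipSigns F Y := by
      rw [← flipSigns_neg]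
      exact fun h => hne (hinj h)
    by_cases he : e ∈ F
    · obtain ⟨Z, hZ, h0, hp, hm⟩ := M.elimination _ hY _ hX
        (fun h => hne' (by rw [h, neg_neg])) e (by simp [flipSigns, he, hYe])
        (by simp [flipSigns, he, hXe])
      refine ⟨flipSigns F Z, by rwa [Set.mem_ofPred_eq, flipSigns_flipSigns],
        by simp [flipSigns, h0], fun f hf => ?_, fun f hf => ?_⟩ <;>
      · have h1 := hp f
        have h2 := hm f
        by_cases hfF : f ∈ F <;> simp only [flipSigns, hfF, if_true, if_false] at h1 h2 hf <;>
          revert h1 h2 hf <;> generalize X f = a <;> generalize Y f = b <;>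
          generalize Z f = c <;> revert a b c <;> decide
    · obtain ⟨Z, hZ, h0, hp, hm⟩ := M.elimination _ hX _ hY hne' e (by simp [flipSigns, he, hXe])
        (by simp [flipSigns, he, hYe])
      refine ⟨flipSigns F Z, by rwa [Set.mem_ofPred_eq, flipSigns_flipSigns],
        by simp [flipSigns, h0], fun f hf => ?_, fun f hf => ?_⟩ <;>
      · have h1 := hp f
        have h2 := hm f
        by_cases hfF : f ∈ F <;> simp only [flipSigns, hfF, if_true, if_false] at h1 h2 hf <;>
          revert h1 h2 hf <;> generalize X f = a <;> generalize Y f = b <;>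
          generalize Z f = c <;> revert a b c <;> decide

/-- The oriented matroid `π · M`, with the element `e` of `M` renamed to `π e`. -/
def relabel {E E' : Type*} (M : OrientedMatroid E) (π : E ≃ E') : OrientedMatroid E' where
  circuits := {X | X ∘ π ∈ M.circuits}
  zero_notMem h := M.zero_notMem h
  neg_mem X hX := M.neg_mem _ hX
  incomparable X hX Y hY h := by
    rcases M.incomparable _ hX _ hY (fun e he => h he) with h' | h'
    · exact Or.inl (π.surjective.injective_comp_right h')
    · exact Or.inr (π.surjective.injective_comp_right h')
  elimination X hX Y hY hne e hXe hYe := by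
    obtain ⟨Z, hZ, h0, hp, hm⟩ := M.elimination _ hX _ hY
      (fun h => hne (π.surjective.injective_comp_right h)) (π.symm e)
      (by simpa using hXe) (by simpa using hYe)
    refine ⟨Z ∘ π.symm, ?_, h0, fun f hf => ?_, fun f hf => ?_⟩
    · have : (Z ∘ π.symm) ∘ π = Z := by
        funext x
        simp
      rwa [Set.mem_ofPred_eq, this]
    · simpa using hp _ hf
    · simpa using hm _ hf

/-- A basis: an inclusion-maximal set that contains no circuit. -/
def IsBasis {E : Type*} (M : OrientedMatroid E) (B : Set E) : Prop :=
  Maximal (fun I : Set E => ∀ X ∈ M.circuits, ¬ Function.support X ⊆ I) B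

/-- `V` realizes `M`: the circuits of `M` are the sign vectors of the (nonzero) linear dependencies
of the columns of `V` with inclusion-minimal support. -/
def IsRealizedBy {r E : Type*} [Fintype E] (M : OrientedMatroid E) (V : Matrix r E ℝ) : Prop :=
  M.circuits = {X | ∃ x : E → ℝ, x ≠ 0 ∧ V *ᵥ x = 0 ∧
    (¬ ∃ x' : E → ℝ, x' ≠ 0 ∧ V *ᵥ x' = 0 ∧ Function.support x' ⊂ Function.support x) ∧
    X = fun e => SignType.sign (x e)}

end OrientedMatroid

/-- The `r × k` matrix whose columns are the points `(1, x, x², …, x^(r-1))` on the moment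
curve. -/
def momentMatrix (r : ℕ) {k : ℕ} (x : Fin k → ℝ) : Matrix (Fin r) (Fin k) ℝ :=
  Matrix.of fun i j => x j ^ (i : ℕ)

/-- `M` is the alternating matroid of rank `r` on the ground set `Fin k`, i.e. the oriented matroid
realized by `k` sequential points on the moment curve. -/
def OrientedMatroid.IsAlternating {k : ℕ} (M : OrientedMatroid (Fin k)) (r : ℕ) : Prop :=
  ∃ x : Fin k → ℝ, StrictMono x ∧ M.IsRealizedBy (momentMatrix r x)

/-! ### P-matroids and their extensions

The ground set of `2n` elements is `Fin n ⊕ Fin n`, where `Sum.inl i` stands for `i ∈ S` and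
`Sum.inr i` for the complementary element `i + n ∈ T`. Complementation is `Sum.swap`. Ground sets
of extensions are `Option (Fin n ⊕ Fin n)`, where the new element `q` is `none`. -/

/-- The complementary set `{i | i ∉ v} ∪ {i + n | i ∈ v}`. -/
def complementarySet {n : ℕ} (v : Finset (Fin n)) : Set (Fin n ⊕ Fin n) :=
  {e | Sum.elim (fun i => i ∉ v) (fun i => i ∈ v) e}

/-- A P-matroid: all sets of `n` elements without a complementary pair (among them `S`) are bases,
and there is no almost-complementary sign-reversing circuit, i.e. in each circuit whose support
contains exactly one complementary pair, the two elements of this pair have the same sign. -/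
def OrientedMatroid.IsPMatroid {n : ℕ} (M : OrientedMatroid (Fin n ⊕ Fin n)) : Prop :=
  (∀ v : Finset (Fin n), M.IsBasis (complementarySet v)) ∧
    ∀ X ∈ M.circuits, ∀ i : Fin n,
      (∀ j : Fin n, (X (Sum.inl j) ≠ 0 ∧ X (Sum.inr j) ≠ 0) ↔ j = i) →
        X (Sum.inl i) = X (Sum.inr i)

/-- A cyclic-P-matroid: a P-matroid that is, up to reorientation and relabeling, the alternating
matroid of rank `n` on `2n` elements. -/
def OrientedMatroid.IsCyclicPMatroid {n : ℕ} (M : OrientedMatroid (Fin n ⊕ Fin n)) : Prop :=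
  M.IsPMatroid ∧ ∃ (π : Fin n ⊕ Fin n ≃ Fin (2 * n)) (F : Finset (Fin n ⊕ Fin n)),
    ((M.reorient F).relabel π).IsAlternating n

/-- The conditions on an ordering `π` of the `2n` elements and a set `F` of reoriented elements that
characterize cyclic-P-matroids: the intervals between complementary elements form a balanced
parentheses expression, and exactly one of `e` and its complement is in `F` if
`(|π e - π (complement of e)| - 1) / 2` is even, and both or none otherwise. -/
def IsCyclicPPair {n : ℕ} (π : Fin n ⊕ Fin n ≃ Fin (2 * n)) (F : Finset (Fin n ⊕ Fin n)) : Prop :=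
  (∀ e f : Fin n ⊕ Fin n, π e < π e.swap →
    (π f ∈ Set.Icc (π e) (π e.swap) ↔ π f.swap ∈ Set.Icc (π e) (π e.swap))) ∧
  ∀ e : Fin n ⊕ Fin n,
    if Even ((|((π e : ℕ) : ℤ) - ((π e.swap : ℕ) : ℤ)| - 1) / 2) then Xor (e ∈ F) (e.swap ∈ F)
    else (e ∈ F ↔ e.swap ∈ F)

/-- `M'` is an extension of `M`: deleting `q` from `M'` gives `M`. -/
def OrientedMatroid.IsExtension {E : Type*} (M' : OrientedMatroid (Option E))
    (M : OrientedMatroid E) : Prop :=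
  M.circuits = {X | (fun e : Option E => e.elim 0 X) ∈ M'.circuits}

/-- The ordering of the `2n` elements of `E` obtained from an ordering `π` of `E ∪ {q}` by
leaving out `q`. -/
def restrictOrder {n : ℕ} (π : Option (Fin n ⊕ Fin n) ≃ Fin (2 * n + 1)) :
    Fin n ⊕ Fin n ≃ Fin (2 * n) :=
  Equiv.removeNone (π.trans (finSuccEquiv' (π none)))

/-- `M'` is a simple extension of the cyclic-P-matroid `M`, with ordering `π` of the extended ground
set and set `F` of reoriented elements: `M'` is an extension of `M`, the matroid `π · (₋F M')` is
the alternating matroid of rank `n` on `2n + 1` elements, and the restrictions of `π` and `F` to the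
ground set of `M` satisfy the conditions for cyclic-P-matroids. -/
def IsSimpleExtension {n : ℕ} (M' : OrientedMatroid (Option (Fin n ⊕ Fin n)))
    (M : OrientedMatroid (Fin n ⊕ Fin n)) (π : Option (Fin n ⊕ Fin n) ≃ Fin (2 * n + 1))
    (F : Finset (Option (Fin n ⊕ Fin n))) : Prop :=
  M.IsCyclicPMatroid ∧ M'.IsExtension M ∧
    ((M'.reorient F).relabel π).IsAlternating n ∧
    IsCyclicPPair (restrictOrder π) (Finset.univ.filter fun e => some e ∈ F)

/-- `o` is the orientation associated with the extension `M'`: the outmap at `v` consists of the `i`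
such that `i` or `i + n` is negative in the fundamental circuit `C(B, q)` with
`B = {i | i ∉ v} ∪ {i + n | i ∈ v}` (the circuit with support `B ∪ {q}` in which `q` is positive;
it is unique). -/
def IsAssociatedOrientation {n : ℕ} (M' : OrientedMatroid (Option (Fin n ⊕ Fin n)))
    (o : Finset (Fin n) → Finset (Fin n)) : Prop :=
  ∀ v : Finset (Fin n), ∃ C ∈ M'.circuits,
    Function.support C = insert none (some '' complementarySet v) ∧ C none = 1 ∧
      ∀ i, i ∈ o v ↔ C (some (Sum.inl i)) = -1 ∨ C (some (Sum.inr i)) = -1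

/-- The matrix `[I, -M, -q]` of a P-LCP instance. -/
def plcpMatrix {n : ℕ} (M : Matrix (Fin n) (Fin n) ℝ) (q : Fin n → ℝ) :
    Matrix (Fin n) (Option (Fin n ⊕ Fin n)) ℝ :=
  Matrix.of fun i e => match e with
    | some (Sum.inl j) => (1 : Matrix (Fin n) (Fin n) ℝ) i j
    | some (Sum.inr j) => -M i j
    | none => -q i

/-- The permuted and negated moment curve points: the column of the element `e` is the point on the
moment curve with parameter `x (π e)`, negated if `e ∈ F`. -/
def signedMomentMatrix {n : ℕ} (π : Option (Fin n ⊕ Fin n) ≃ Fin (2 * n + 1))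
    (F : Finset (Option (Fin n ⊕ Fin n))) (x : Fin (2 * n + 1) → ℝ) :
    Matrix (Fin n) (Option (Fin n ⊕ Fin n)) ℝ :=
  Matrix.of fun i e => (if e ∈ F then -1 else 1) * x (π e) ^ (i : ℕ)

/-- The submatrix `V_S` of the columns in `S`. -/
def colsS {n : ℕ} (V : Matrix (Fin n) (Option (Fin n ⊕ Fin n)) ℝ) : Matrix (Fin n) (Fin n) ℝ :=
  Matrix.of fun i j => V i (some (Sum.inl j))

/-- The submatrix `V_T` of the columns in `T`. -/
def colsT {n : ℕ} (V : Matrix (Fin n) (Option (Fin n ⊕ Fin n)) ℝ) : Matrix (Fin n) (Fin n) ℝ :=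
  Matrix.of fun i j => V i (some (Sum.inr j))

/-- The column of `q`. -/
def colQ {n : ℕ} (V : Matrix (Fin n) (Option (Fin n ⊕ Fin n)) ℝ) : Fin n → ℝ :=
  fun i => V i none

/-! ### Matoušek orientations -/

/-! Over the field with two elements `m` is linear: `i ∈ m v` exactly when an odd number of elements
of `v` influence `i`. As `G` is acyclic apart from its loops, this map is unitriangular on every
face, hence bijective there, and the sinks of faces exist and are unique.

Necessity. A realization has `q > 0` because `∅` is the sink. The outmaps at `{x}` and `{y}` compare
entries of columns of `M` with `q`, and for an induced `G₁` or `G₂` these comparisons contradict the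
outmap at `{x, y}` (`trans_of_realizes`, `comparable_of_realizes`). Without `G₁` and `G₂`, `G` is a
partial order in which the predecessors of each vertex form a chain; its covering relation is the
branching.

Sufficiency. Such an order is the nesting order of `n` pairs of parentheses (`exists_isNesting`).
Place the parentheses on the moment curve in this order, with `q` last. The dependency of `n + 1`
points is a divided difference, so up to scaling the sign at a point is the product of the signs of
its differences to the other points. Adding `j` to `v` moves `j` from its opening to its closing
parenthesis and past exactly the proper successors of `j`; so the sign at `i` changes once for each
proper predecessor of `i` in `v`. The factors `elementSign` absorb everything else, and what remains
is the parity formula for `m` (`elementSign_mul_prod_eq_neg_one_iff`). The same computation gives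
equal signs to the pair in an almost complementary circuit, and by Cramer's rule this yields a
P-matrix. Only the order of the points enters, so every increasing choice of reals works. -/

theorem symmDiff_singleton_of_notMem {α : Type*} [DecidableEq α] {v : Finset α} {d : α}
    (h : d ∉ v) : symmDiff v {d} = insert d v := by
  ext a
  by_cases ha : a = d <;> simp [Finset.mem_symmDiff, ha, h]

section Matousek

open Classical in
/-- The set of dimensions influenced by `d`. -/
noncomputable def influenced {n : ℕ} (G : Digraph (Fin n)) (d : Fin n) : Finset (Fin n) :=
  Finset.univ.filter fun e => G.Adj d e

variable {n : ℕ} {G : Digraph (Fin n)} {m : Finset (Fin n) → Finset (Fin n)}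

theorem mem_influenced {d e : Fin n} : e ∈ influenced G d ↔ G.Adj d e := by
  simp [influenced]

theorem IsMatousek.map_symmDiff_singleton (hm : IsMatousek G m) (v : Finset (Fin n)) (d : Fin n) :
    m (symmDiff v {d}) = symmDiff (m v) (influenced G d) := by
  ext e
  have h := hm.2.2 d e v
  rw [← mem_influenced] at h
  rw [Finset.mem_symmDiff]
  unfold Xor at h
  tauto

theorem IsMatousek.map_symmDiff (hm : IsMatousek G m) (v u : Finset (Fin n)) :
    m (symmDiff v u) = symmDiff (m v) (m u) := by
  induction u using Finset.induction_on with
  | empty => rw [hm.2.1, ← Finset.bot_eq_empty, symmDiff_bot, symmDiff_bot]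
  | insert d u hd ih =>
    rw [← symmDiff_singleton_of_notMem hd, ← symmDiff_assoc, hm.map_symmDiff_singleton,
      hm.map_symmDiff_singleton, ih, symmDiff_assoc]

theorem IsMatousek.singleton (hm : IsMatousek G m) (d : Fin n) : m {d} = influenced G d := by
  have h := hm.map_symmDiff_singleton ∅ d
  rwa [hm.2.1, ← Finset.bot_eq_empty, bot_symmDiff, bot_symmDiff] at h

theorem IsMatousek.pair (hm : IsMatousek G m) {d e : Fin n} (h : d ≠ e) :
    m {d, e} = symmDiff (influenced G d) (influenced G e) := by
  rw [← hm.singleton d, ← hm.map_symmDiff_singleton, symmDiff_singleton_of_notMem (by simpa using h.symm),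
    Finset.pair_comm]

open Classical in
theorem IsMatousek.mem_iff_odd (hm : IsMatousek G m) (v : Finset (Fin n)) (e : Fin n) :
    e ∈ m v ↔ Odd (v.filter fun d => G.Adj d e).card := by
  induction v using Finset.induction_on with
  | empty => simp [hm.2.1]
  | insert d v hd ih =>
    rw [← symmDiff_singleton_of_notMem hd, hm.map_symmDiff_singleton, symmDiff_singleton_of_notMem hd,
      Finset.mem_symmDiff, ih, mem_influenced, Finset.filter_insert]
    by_cases h : G.Adj d e
    · rw [if_pos h, Finset.card_insert_of_notMem (by simp [hd]), Nat.odd_add_one]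
      tauto
    · rw [if_neg h]
      tauto

/-- A cycle of non-loop edges would start with an edge whose distinct endpoints reach each other; on
a finite type irreflexivity of the transitive closure suffices. -/
theorem IsInfluenceGraph.wellFounded (hG : IsInfluenceGraph G) :
    WellFounded fun d e => G.Adj d e ∧ d ≠ e := by
  have hirr : ∀ d, ¬ Relation.TransGen (fun d e => G.Adj d e ∧ d ≠ e) d d := by
    intro d h
    obtain ⟨e, hde, hed⟩ := Relation.TransGen.head'_iff.1 h
    have hed' : Relation.ReflTransGen G.Adj e d :=
      Relation.ReflTransGen.mono (fun _ _ h => And.left h) _ _ hed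
    exact hde.2 (hG.2 d e (.single hde.1) (Relation.TransGen.trans_right hed' (.single (hG.1 d))))
  have : Std.Irrefl (Relation.TransGen fun d e => G.Adj d e ∧ d ≠ e) := ⟨hirr⟩
  exact Subrelation.wf (r := Relation.TransGen fun d e => G.Adj d e ∧ d ≠ e)
    (fun h => Relation.TransGen.single h) (Finite.wellFounded_of_trans_of_irrefl _)

/-- Trivial kernel on every face: an element of `u` without other predecessors in `u` is counted
once, by its loop, so it belongs to `m u`. -/
theorem IsMatousek.inter_ne_empty (hm : IsMatousek G m) {u D : Finset (Fin n)} (hu : u ⊆ D)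
    (hne : u.Nonempty) : m u ∩ D ≠ ∅ := by
  classical
  obtain ⟨d, hd, hmin⟩ := hm.1.wellFounded.has_min (u : Set (Fin n)) (by simpa using hne)
  have h1 : u.filter (fun e => G.Adj e d) = {d} := by
    ext e
    simp only [Finset.mem_filter, Finset.mem_singleton]
    constructor
    · rintro ⟨he, hed⟩
      by_contra hne
      exact hmin e he ⟨hed, hne⟩
    · rintro rfl
      exact ⟨hd, hm.1.1 _⟩
  have h2 : d ∈ m u := by
    rw [hm.mem_iff_odd, h1]
    simp
  exact Finset.ne_empty_of_mem (Finset.mem_inter.2 ⟨h2, hu hd⟩)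

theorem IsMatousek.isUSO (hm : IsMatousek G m) : IsUSO m := by
  refine ⟨fun v d => ?_, fun D v => ?_⟩
  · have h := (hm.2.2 d d v).2 (hm.1.1 d)
    unfold Xor at h
    tauto
  -- By linearity, injectivity on the subsets of `D` is triviality of the kernel; surjectivity then
  -- follows by counting.
  have hinj : ∀ u₁ ⊆ D, ∀ u₂ ⊆ D, m u₁ ∩ D = m u₂ ∩ D → u₁ = u₂ := by
    intro u₁ h₁ u₂ h₂ h
    by_contra hne
    have hsub : symmDiff u₁ u₂ ⊆ D := fun a ha => by
      rcases Finset.mem_symmDiff.1 ha with h | h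
      exacts [h₁ h.1, h₂ h.1]
    refine hm.inter_ne_empty hsub (Finset.nonempty_iff_ne_empty.2
      fun h => hne (symmDiff_eq_bot.1 h)) ?_
    rw [hm.map_symmDiff]
    ext a
    have := Finset.ext_iff.1 h a
    simp only [Finset.mem_inter, Finset.mem_symmDiff, Finset.notMem_empty, iff_false] at this ⊢
    tauto
  have hsurj : ∃ u ⊆ D, m u ∩ D = m v ∩ D := by
    obtain ⟨u, hu, h⟩ := Finset.surj_on_of_inj_on_of_card_le (s := D.powerset) (t := D.powerset)
      (fun u _ => m u ∩ D) (fun u _ => Finset.mem_powerset.2 Finset.inter_subset_right)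
      (fun u₁ u₂ h₁ h₂ h => hinj u₁ (Finset.mem_powerset.1 h₁) u₂ (Finset.mem_powerset.1 h₂) h)
      le_rfl (m v ∩ D) (Finset.mem_powerset.2 Finset.inter_subset_right)
    exact ⟨u, Finset.mem_powerset.1 hu, h.symm⟩
  have hkey : ∀ u, m (symmDiff v u) ∩ D = ∅ ↔ m u ∩ D = m v ∩ D := by
    intro u
    rw [hm.map_symmDiff, Finset.ext_iff, Finset.ext_iff]
    refine forall_congr' fun a => ?_
    simp only [Finset.mem_inter, Finset.mem_symmDiff, Finset.notMem_empty, iff_false]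
    tauto
  obtain ⟨u, hu, hum⟩ := hsurj
  refine ⟨symmDiff v u, ⟨by rwa [symmDiff_symmDiff_cancel_left], (hkey u).2 hum⟩, ?_⟩
  rintro w ⟨hw, hwD⟩
  have hw' : w = symmDiff v (symmDiff v w) := (symmDiff_symmDiff_cancel_left v w).symm
  rw [hw'] at hwD
  rw [hw', hinj _ hw _ hu (((hkey _).1 hwD).trans hum.symm)]

/-! ### Influence graphs that are closures of branchings -/

/-- `G` is transitive and the predecessors of each vertex are pairwise adjacent. -/
structure IsForestOrder {V : Type*} (G : Digraph V) : Prop where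
  refl : ∀ a, G.Adj a a
  antisymm : ∀ a b, G.Adj a b → G.Adj b a → a = b
  trans : ∀ a b c, G.Adj a b → G.Adj b c → G.Adj a c
  comparable : ∀ a b c, G.Adj a c → G.Adj b c → G.Adj a b ∨ G.Adj b a

theorem containsInduced_of_forall {V W : Type*} {G : Digraph V} {H : Digraph W} (f : W → V)
    (hf : Function.Injective f) (h : ∀ a b, G.Adj (f a) (f b) ↔ H.Adj a b) :
    ContainsInduced G H :=
  ⟨⟨⟨f, hf⟩, h _ _⟩⟩

/-- A violation of transitivity spans an induced `G₁`, and two incomparable predecessors of a vertex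
span an induced `G₂`; acyclicity rules out the backward edges. -/
theorem IsInfluenceGraph.isForestOrder (hG : IsInfluenceGraph G)
    (h1 : ¬ ContainsInduced G forbiddenG1) (h2 : ¬ ContainsInduced G forbiddenG2) :
    IsForestOrder G := by
  have hanti : ∀ a b, G.Adj a b → G.Adj b a → a = b := fun a b hab hba =>
    hG.2 a b (.single hab) (.single hba)
  have htrans : ∀ a b c, G.Adj a b → G.Adj b c → G.Adj a c := by
    intro a b c hab hbc
    by_contra hac
    have hab' : a ≠ b := fun h => hac (h ▸ hbc)
    have hbc' : b ≠ c := fun h => hac (h ▸ hab)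
    have hac' : a ≠ c := fun h => hac (h ▸ hG.1 a)
    have hba : ¬ G.Adj b a := fun h => hab' (hanti _ _ hab h)
    have hcb : ¬ G.Adj c b := fun h => hbc' (hanti _ _ hbc h)
    have hca : ¬ G.Adj c a := fun h =>
      hab' (hG.2 a b (.single hab) ((Relation.TransGen.single hbc).tail h))
    refine h1 (containsInduced_of_forall ![a, b, c] ?_ ?_)
    · intro i j
      fin_cases i <;> fin_cases j <;> simp [hab', hbc', hac', hab'.symm, hbc'.symm, hac'.symm]
    · intro i j
      fin_cases i <;> fin_cases j <;> simp [forbiddenG1, hG.1, *]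
  refine ⟨hG.1, hanti, htrans, fun a b c hac hbc => ?_⟩
  by_contra! hab
  have hab' : a ≠ b := fun h => hab.1 (h ▸ hG.1 a)
  have hac' : a ≠ c := fun h => hab.2 (h ▸ hbc)
  have hbc' : b ≠ c := fun h => hab.1 (h ▸ hac)
  have hca : ¬ G.Adj c a := fun h => hac' (hanti _ _ hac h)
  have hcb : ¬ G.Adj c b := fun h => hbc' (hanti _ _ hbc h)
  refine h2 (containsInduced_of_forall ![a, b, c] ?_ ?_)
  · intro i j
    fin_cases i <;> fin_cases j <;> simp [hab', hbc', hac', hab'.symm, hbc'.symm, hac'.symm]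
  · intro i j
    fin_cases i <;> fin_cases j <;> simp [forbiddenG2, hG.1, *]

theorem IsForestOrder.not_containsInduced {V : Type*} {G : Digraph V} (hG : IsForestOrder G) :
    ¬ ContainsInduced G forbiddenG1 ∧ ¬ ContainsInduced G forbiddenG2 := by
  constructor <;> rintro ⟨f⟩
  · have h01 := f.map_rel_iff.2 (show forbiddenG1.Adj 0 1 by simp [forbiddenG1])
    have h12 := f.map_rel_iff.2 (show forbiddenG1.Adj 1 2 by simp [forbiddenG1])
    simpa [forbiddenG1] using f.map_rel_iff.1 (hG.trans _ _ _ h01 h12)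
  · have h02 := f.map_rel_iff.2 (show forbiddenG2.Adj 0 2 by simp [forbiddenG2])
    have h12 := f.map_rel_iff.2 (show forbiddenG2.Adj 1 2 by simp [forbiddenG2])
    rcases hG.comparable _ _ _ h02 h12 with h | h <;>
    simpa [forbiddenG2] using f.map_rel_iff.1 h

/-- The branching is the covering relation. Two elements covered by `c` are comparable, hence equal,
and a finite order is generated by its covers. -/
theorem IsForestOrder.isClosureOfBranching {V : Type*} [Finite V] {G : Digraph V}
    (hG : IsForestOrder G) : IsClosureOfBranching G := by
  classical
  have := Fintype.ofFinite V
  let : PartialOrder V :=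
    { le := G.Adj
      le_refl := hG.refl
      le_trans := hG.trans
      le_antisymm := hG.antisymm }
  let : LocallyFiniteOrder V := Fintype.toLocallyFiniteOrder
  refine ⟨⟨fun a b => a ⋖ b⟩, ⟨fun a b c hac hbc => ?_, fun a ha => ?_⟩,
    fun a b => le_iff_reflTransGen_covBy (x := a) (y := b)⟩
  · rcases hG.comparable a b c hac.le hbc.le with h | h
    · exact (show a ≤ b from h).eq_of_not_lt fun h' => hac.2 h' hbc.lt
    · exact ((show b ≤ a from h).eq_of_not_lt fun h' => hbc.2 h' hac.lt).symm
  · exact lt_irrefl a (lt_iff_transGen_covBy.2 ha)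

/-- Walking backwards in a branching is deterministic, so two ancestors of `c` lie on one backward
walk and one of them reaches the other. -/
theorem IsClosureOfBranching.isForestOrder {V : Type*} {G : Digraph V}
    (h : IsClosureOfBranching G) : IsForestOrder G := by
  obtain ⟨B, ⟨hB, hacyc⟩, hGB⟩ := h
  refine ⟨fun a => (hGB a a).2 .refl, fun a b hab hba => ?_,
    fun a b c hab hbc => (hGB a c).2 (((hGB a b).1 hab).trans ((hGB b c).1 hbc)),
    fun a b c hac hbc => ?_⟩
  · rcases Relation.reflTransGen_iff_eq_or_transGen.1 ((hGB a b).1 hab) with h | h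
    · exact h.symm
    · exact absurd (h.trans_left ((hGB b a).1 hba)) (hacyc a)
  · have hU : Relator.RightUnique (Function.swap B.Adj) := fun _ _ _ h₁ h₂ => hB _ _ _ h₁ h₂
    have hac' := Relation.reflTransGen_swap.2 ((hGB a c).1 hac)
    have hbc' := Relation.reflTransGen_swap.2 ((hGB b c).1 hbc)
    rcases Relation.ReflTransGen.total_of_right_unique hU hac' hbc' with h | h
    · exact Or.inr ((hGB b a).2 (Relation.reflTransGen_swap.1 h))
    · exact Or.inl ((hGB a b).2 (Relation.reflTransGen_swap.1 h))

/-! ### Obstructions to realizability -/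

/-- The vector `w` is eliminated through `w = q + M z`, and non-degeneracy makes the inequalities
strict on both sides of the outmap. -/
theorem PLCPRealizes.exists_solution {M : Matrix (Fin n) (Fin n) ℝ} {q : Fin n → ℝ}
    {o : Finset (Fin n) → Finset (Fin n)} (h : PLCPRealizes M q o) (B : Finset (Fin n)) :
    ∃ z : Fin n → ℝ,
      (∀ i ∈ B, q i + ∑ j ∈ B, M i j * z j = 0 ∧ (i ∈ o B → z i < 0) ∧ (i ∉ o B → 0 < z i)) ∧
      ∀ i ∉ B, (i ∈ o B → q i + ∑ j ∈ B, M i j * z j < 0) ∧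
        (i ∉ o B → 0 < q i + ∑ j ∈ B, M i j * z j) := by
  obtain ⟨w, z, hc, ho⟩ := h.2.2 B
  have hw : ∀ i, w i = q i + ∑ j ∈ B, M i j * z j := by
    intro i
    have h1 := congrFun hc.1 i
    have h2 : (M *ᵥ z) i = ∑ j ∈ B, M i j * z j :=
      (Finset.sum_subset (Finset.subset_univ B) fun j _ hj => by rw [hc.2.2 j hj, mul_zero]).symm
    rw [Pi.sub_apply, h2] at h1
    linarith
  have hnd := h.2.1 B w z hc
  refine ⟨z, fun i hi => ⟨(hw i).symm.trans (hc.2.1 i hi), fun h => ?_, fun h => ?_⟩,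
    fun i hi => ⟨fun h => ?_, fun h => ?_⟩⟩
  · exact lt_of_le_of_ne ((ho i).1 h).2 fun h0 => hnd i ⟨hc.2.1 i hi, h0⟩
  · by_contra h0
    exact h ((ho i).2 ⟨(hc.2.1 i hi).le, not_lt.1 h0⟩)
  · rw [← hw]
    exact lt_of_le_of_ne ((ho i).1 h).1 fun h0 => hnd i ⟨h0, hc.2.2 i hi⟩
  · rw [← hw]
    by_contra h0
    exact h ((ho i).2 ⟨not_lt.1 h0, (hc.2.2 i hi).le⟩)

theorem IsMatousek.pos_of_realizes (hm : IsMatousek G m) {M : Matrix (Fin n) (Fin n) ℝ}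
    {q : Fin n → ℝ} (h : PLCPRealizes M q m) (i : Fin n) : 0 < q i := by
  obtain ⟨z, -, hz⟩ := h.exists_solution ∅
  simpa using (hz i (by simp)).2 (by simp [hm.2.1])

/-- The outmap at `{i}`: the scale `t` is the coordinate `z i`, negative because `i` has a loop, and
the influence of `i` on `j` is the sign of `w j`. -/
theorem IsMatousek.entry_of_realizes (hm : IsMatousek G m) {M : Matrix (Fin n) (Fin n) ℝ}
    {q : Fin n → ℝ} (h : PLCPRealizes M q m) (i : Fin n) :
    ∃ t < 0, M i i * t = -q i ∧ ∀ j ≠ i, (G.Adj i j → M j i * t < -q j) ∧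
      (¬ G.Adj i j → -q j < M j i * t) := by
  obtain ⟨z, hz, hz'⟩ := h.exists_solution {i}
  simp only [Finset.mem_singleton, Finset.sum_singleton, hm.singleton, mem_influenced] at hz hz'
  obtain ⟨h1, h2, -⟩ := hz i rfl
  refine ⟨z i, h2 (hm.1.1 i), by linarith, fun j hj => ⟨fun h => ?_, fun h => ?_⟩⟩
  · linarith [(hz' j hj).1 h]
  · linarith [(hz' j hj).2 h]

/-- Otherwise the solution at `{x, y}` has `u x < 0 < u y`, with row `y` zero and row `z` negative.
But `q y` times row `z` minus `q z` times row `y` has no constant term, and the inequalities at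
`{x}` and `{y}` make both of its remaining terms positive. -/
theorem IsMatousek.trans_of_realizes (hm : IsMatousek G m) {M : Matrix (Fin n) (Fin n) ℝ}
    {q : Fin n → ℝ} (h : PLCPRealizes M q m) {x y z : Fin n} (hxy : x ≠ y) (hxz : x ≠ z)
    (hyz : y ≠ z) (hGxy : G.Adj x y) (hGyz : G.Adj y z) (hGyx : ¬ G.Adj y x) : G.Adj x z := by
  by_contra hGxz
  obtain ⟨s, hs, -, hs'⟩ := hm.entry_of_realizes h x
  obtain ⟨t, ht, hty, ht'⟩ := hm.entry_of_realizes h y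
  have e1 := (hs' y hxy.symm).1 hGxy
  have e2 := (hs' z hxz.symm).2 hGxz
  have e3 := (ht' z hyz.symm).1 hGyz
  obtain ⟨u, hu, hu'⟩ := h.exists_solution {x, y}
  rw [hm.pair hxy] at hu hu'
  simp only [Finset.sum_pair hxy, Finset.mem_symmDiff, mem_influenced] at hu hu'
  have hux := (hu x (by simp)).2.1 (.inl ⟨hm.1.1 x, hGyx⟩)
  obtain ⟨f1, -, huy⟩ := hu y (by simp)
  have huy := huy (by simp [hGxy, hm.1.1 y])
  have f2 := (hu' z (by simp [hxz.symm, hyz.symm])).1 (.inr ⟨hGyz, hGxz⟩)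
  have hqy := hm.pos_of_realizes h y
  have hqz := hm.pos_of_realizes h z
  -- The comparison known at the multiplier `t` is rescaled to `u y`; the ratio `u y / t` is
  -- negative, so the inequality reverses.
  have g1 : q z * M y y * u y < M z y * u y * q y := by
    have h0 : 0 < (M z y * t * q y - q z * (M y y * t)) * (u y / t) := by
      refine mul_pos_of_neg_of_neg ?_ (div_neg_of_pos_of_neg huy ht)
      rw [hty]
      nlinarith
    have h1 : (M z y * t * q y - q z * (M y y * t)) * (u y / t) =
        M z y * u y * q y - q z * M y y * u y := by
      field_simp [ht.ne]
    linarith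
  have g2 : q z * M y x * u x < M z x * u x * q y := by
    have h0 : 0 < (M z x * s * q y - q z * (M y x * s)) * (u x / s) := by
      refine mul_pos ?_ (div_pos_of_neg_of_neg hux hs)
      nlinarith
    have h1 : (M z x * s * q y - q z * (M y x * s)) * (u x / s) =
        M z x * u x * q y - q z * M y x * u x := by
      field_simp [hs.ne]
    linarith
  nlinarith

/-- Otherwise `u x` and `u y` are both negative at `{x, y}`, with row `x` zero and row `z` positive.
But both terms of `q x` times row `z` minus `q z` times row `x` are negative. -/
theorem IsMatousek.comparable_of_realizes (hm : IsMatousek G m) {M : Matrix (Fin n) (Fin n) ℝ}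
    {q : Fin n → ℝ} (h : PLCPRealizes M q m) {x y z : Fin n} (hxy : x ≠ y) (hxz : x ≠ z)
    (hyz : y ≠ z) (hGxz : G.Adj x z) (hGyz : G.Adj y z) (hGyx : ¬ G.Adj y x) : G.Adj x y := by
  by_contra hGxy
  obtain ⟨s, hs, hsx, hs'⟩ := hm.entry_of_realizes h x
  obtain ⟨t, ht, hty, ht'⟩ := hm.entry_of_realizes h y
  have e1 := (hs' z hxz.symm).1 hGxz
  have e2 := (ht' z hyz.symm).1 hGyz
  have e3 := (ht' x hxy).2 hGyx
  obtain ⟨u, hu, hu'⟩ := h.exists_solution {x, y}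
  rw [hm.pair hxy] at hu hu'
  simp only [Finset.sum_pair hxy, Finset.mem_symmDiff, mem_influenced] at hu hu'
  obtain ⟨f1, hux, -⟩ := hu x (by simp)
  have huy := (hu y (by simp)).2.1 (.inr ⟨hm.1.1 y, hGxy⟩)
  have hux := hux (.inl ⟨hm.1.1 x, hGyx⟩)
  have f2 := (hu' z (by simp [hxz.symm, hyz.symm])).2 (by simp [hGxz, hGyz])
  have hqx := hm.pos_of_realizes h x
  have hqz := hm.pos_of_realizes h z
  have g1 : M z x * u x * q x < q z * M x x * u x := by
    have h0 : (M z x * s * q x - q z * (M x x * s)) * (u x / s) < 0 := by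
      refine mul_neg_of_neg_of_pos ?_ (div_pos_of_neg_of_neg hux hs)
      rw [hsx]
      nlinarith
    have h1 : (M z x * s * q x - q z * (M x x * s)) * (u x / s) =
        M z x * u x * q x - q z * M x x * u x := by
      field_simp [hs.ne]
    linarith
  have g2 : M z y * u y * q x < q z * M x y * u y := by
    have h0 : (M z y * t * q x - q z * (M x y * t)) * (u y / t) < 0 := by
      refine mul_neg_of_neg_of_pos ?_ (div_pos_of_neg_of_neg huy ht)
      nlinarith
    have h1 : (M z y * t * q x - q z * (M x y * t)) * (u y / t) =
        M z y * u y * q x - q z * M x y * u y := by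
      field_simp [ht.ne]
    linarith
  nlinarith

theorem IsMatousek.not_containsInduced_of_isRealizable (hm : IsMatousek G m)
    (h : IsRealizable m) : ¬ ContainsInduced G forbiddenG1 ∧ ¬ ContainsInduced G forbiddenG2 := by
  obtain ⟨M, q, h⟩ := h
  constructor <;> rintro ⟨f⟩
  · have hf : ∀ a b, G.Adj (f a) (f b) ↔ forbiddenG1.Adj a b := fun a b => f.map_rel_iff
    have := hm.trans_of_realizes h (x := f 0) (y := f 1) (z := f 2) (by simp) (by simp) (by simp)
    rw [hf, hf, hf, hf] at this
    simp [forbiddenG1] at this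
  · have hf : ∀ a b, G.Adj (f a) (f b) ↔ forbiddenG2.Adj a b := fun a b => f.map_rel_iff
    have := hm.comparable_of_realizes h (x := f 0) (y := f 1) (z := f 2) (by simp) (by simp)
      (by simp)
    rw [hf, hf, hf, hf] at this
    simp [forbiddenG2] at this

end Matousek

/-! ### Nested intervals -/

section Nesting

theorem Finset.exists_gap {ι : Type*} (t : Finset ι) (f : ι → ℚ) (a : ℚ) :
    ∃ c, a < c ∧ ∀ i ∈ t, a < f i → c < f i := by
  have h : ∀ᶠ c in nhdsWithin a (Set.Ioi a), ∀ i ∈ t, a < f i → c < f i := by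
    rw [Filter.eventually_all_finset]
    intro i _
    by_cases hi : a < f i
    · filter_upwards [nhdsWithin_le_nhds (Iio_mem_nhds hi)] with c hc _ using hc
    · exact .of_forall fun c h => absurd h hi
  obtain ⟨c, hc, hac⟩ := (h.and self_mem_nhdsWithin).exists
  exact ⟨c, hac, hc⟩

/-- The intervals `[l i, r i]` and `[l j, r j]` are disjoint or nested, the latter according to the
direction of the edge between `i` and `j`. -/
def NestedAt {V α : Type*} [LinearOrder α] (G : Digraph V) (l r : V → α) (i j : V) : Prop :=
  (G.Adj i j ∧ ¬ G.Adj j i ∧ l i < l j ∧ r j < r i) ∨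
    (G.Adj j i ∧ ¬ G.Adj i j ∧ l j < l i ∧ r i < r j) ∨
    (¬ G.Adj i j ∧ ¬ G.Adj j i ∧ (r i < l j ∨ r j < l i))

theorem NestedAt.symm {V α : Type*} [LinearOrder α] {G : Digraph V} {l r : V → α} {i j : V}
    (h : NestedAt G l r i j) : NestedAt G l r j i := by
  unfold NestedAt at *
  tauto

/-- Induction removing a maximal vertex `v`, a leaf of the forest. Its interval goes to the right of
everything if `v` has no predecessor, and otherwise directly behind the left endpoint of its parent.
Rational endpoints leave room for the insertion. -/
theorem IsForestOrder.exists_nested_of_finset {V : Type*} {G : Digraph V}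
    (hG : IsForestOrder G) (s : Finset V) :
    ∃ l r : V → ℚ, (∀ i ∈ s, l i < r i) ∧ ∀ i ∈ s, ∀ j ∈ s, i ≠ j → NestedAt G l r i j := by
  classical
  let : PartialOrder V :=
    { le := G.Adj
      le_refl := hG.refl
      le_trans := hG.trans
      le_antisymm := hG.antisymm }
  induction s using Finset.strongInduction with
  | H s ih =>
  rcases s.eq_empty_or_nonempty with rfl | hs
  · exact ⟨0, 0, by simp, by simp⟩
  obtain ⟨v, hv⟩ := s.exists_maximal hs
  obtain ⟨l, r, hlr, hn⟩ := ih (s.erase v) (Finset.erase_ssubset hv.1)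
  have hmax : ∀ i ∈ s.erase v, ¬ G.Adj v i := fun i hi h =>
    (Finset.mem_erase.1 hi).1 (hv.eq_of_le (Finset.mem_erase.1 hi).2 h).symm
  obtain ⟨a, b, hab, hN⟩ : ∃ a b : ℚ, a < b ∧ ∀ i ∈ s.erase v,
      (G.Adj i v ∧ l i < a ∧ b < r i) ∨ (¬ G.Adj i v ∧ (r i < a ∨ b < l i)) := by
    rcases ((s.erase v).filter (· ≤ v)).eq_empty_or_nonempty with hP | hP
    · obtain ⟨N, hN⟩ := ((s.erase v).image r).finite_toSet.bddAbove
      refine ⟨N + 1, N + 2, by linarith, fun i hi => .inr ⟨fun h => ?_, .inl ?_⟩⟩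
      · exact Finset.notMem_empty i (hP ▸ Finset.mem_filter.2 ⟨hi, h⟩)
      · have := hN (Finset.mem_coe.2 (Finset.mem_image_of_mem r hi))
        linarith
    -- `p` is the parent of `v`: the predecessors of `v` form a chain, so all of them precede `p`.
    · obtain ⟨p, hp⟩ := Finset.exists_maximal hP
      obtain ⟨hps, hpv⟩ := Finset.mem_filter.1 hp.1
      have hle : ∀ i ∈ s.erase v, G.Adj i v → G.Adj i p := by
        intro i hi hiv
        rcases hG.comparable i p v hiv hpv with h | h
        · exact h
        · exact hp.2 (Finset.mem_filter.2 ⟨hi, hiv⟩) h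
      obtain ⟨c₁, hc₁, hl⟩ := (s.erase v).exists_gap l (l p)
      obtain ⟨c₂, hc₂, hr⟩ := (s.erase v).exists_gap r (l p)
      -- No old endpoint lies in the gap between `l p` and `min c₁ c₂`, so `[a, b]` has the same
      -- position as `l p` relative to every interval other than that of `p`.
      obtain ⟨b, hb, hbc⟩ := exists_between (lt_min hc₁ hc₂)
      obtain ⟨a, ha, hab⟩ := exists_between hb
      obtain ⟨hb₁, hb₂⟩ := lt_min_iff.1 hbc
      refine ⟨a, b, hab, fun i hi => ?_⟩
      by_cases hiv : G.Adj i v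
      · refine .inl ⟨hiv, ?_⟩
        by_cases hip : i = p
        · subst hip
          exact ⟨ha, hb₂.trans (hr _ hi (hlr _ hi))⟩
        · have h1 := hle i hi hiv
          rcases hn i hi p hps hip with h | h | h
          · exact ⟨h.2.2.1.trans ha, (hb₂.trans (hr p hps (hlr p hps))).trans h.2.2.2⟩
          · exact absurd h1 h.2.1
          · exact absurd h1 h.1
      · refine .inr ⟨hiv, ?_⟩
        have hip : i ≠ p := fun h => hiv (h ▸ hpv)
        rcases hn i hi p hps hip with h | h | h
        · exact absurd (hG.trans _ _ _ h.1 hpv) hiv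
        · exact .inr (hb₁.trans (hl i hi h.2.2.1))
        · rcases h.2.2 with h | h
          · exact .inl (h.trans ha)
          · exact .inr (hb₁.trans (hl i hi ((hlr p hps).trans h)))
  have hvi : ∀ i ∈ s.erase v, i ≠ v := fun i hi => (Finset.mem_erase.1 hi).1
  have hnew : ∀ i ∈ s, i ≠ v → NestedAt G (Function.update l v a) (Function.update r v b) i v := by
    intro i hi hne
    have hi' := Finset.mem_erase.2 ⟨hne, hi⟩
    have h1 := hN i hi'
    have h2 := hmax i hi'
    simp only [NestedAt, Function.update_self, Function.update_of_ne hne]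
    tauto
  refine ⟨Function.update l v a, Function.update r v b, fun i hi => ?_, fun i hi j hj hij => ?_⟩
  · by_cases h : i = v
    · subst h
      simpa using hab
    · simpa [h] using hlr i (Finset.mem_erase.2 ⟨h, hi⟩)
  · by_cases h : i = v
    · subst h
      exact (hnew j hj hij.symm).symm
    by_cases h' : j = v
    · subst h'
      exact hnew i hi hij
    have := hn i (Finset.mem_erase.2 ⟨h, hi⟩) j (Finset.mem_erase.2 ⟨h', hj⟩) hij
    simpa only [NestedAt, Function.update_of_ne h, Function.update_of_ne h'] using this

theorem exists_equiv_fin_of_injective {α β : Type*} [Fintype α] [LinearOrder β] (f : α → β)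
    (hf : Function.Injective f) {k : ℕ} (hk : Fintype.card α = k) :
    ∃ π : α ≃ Fin k, ∀ a b, π a < π b ↔ f a < f b := by
  let : LinearOrder α := LinearOrder.lift' f hf
  let e := Fintype.orderIsoFinOfCardEq α hk
  exact ⟨e.symm.toEquiv, fun a b => e.symm.lt_iff_lt⟩

/-- In the ordering `π`, the elements `i ∈ S` and their complements are the opening and closing
parentheses of a balanced expression whose nesting is described by `G`. -/
structure IsNesting {n : ℕ} (G : Digraph (Fin n)) (π : Fin n ⊕ Fin n ≃ Fin (2 * n)) : Prop where
  lt : ∀ i, π (.inl i) < π (.inr i)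
  nested : ∀ i j, i ≠ j → NestedAt G (fun i => π (.inl i)) (fun i => π (.inr i)) i j

theorem IsForestOrder.exists_isNesting {n : ℕ} {G : Digraph (Fin n)} (hG : IsForestOrder G) :
    ∃ π : Fin n ⊕ Fin n ≃ Fin (2 * n), IsNesting G π := by
  obtain ⟨l, r, hlr, hn⟩ := hG.exists_nested_of_finset Finset.univ
  replace hlr : ∀ i, l i < r i := fun i => hlr i (Finset.mem_univ i)
  replace hn : ∀ i j, i ≠ j → NestedAt G l r i j :=
    fun i j => hn i (Finset.mem_univ i) j (Finset.mem_univ j)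
  have hinj : Function.Injective (Sum.elim l r) := by
    have key : ∀ i j, i ≠ j → l i ≠ l j ∧ r i ≠ r j ∧ l i ≠ r j := by
      intro i j hij
      have := hlr i
      have := hlr j
      rcases hn i j hij with h | h | ⟨-, -, h | h⟩
      · exact ⟨h.2.2.1.ne, h.2.2.2.ne', by linarith [h.2.2.1] |> fun h' : l i < r j => h'.ne⟩
      · exact ⟨h.2.2.1.ne', h.2.2.2.ne, by linarith [h.2.2.2] |> fun h' : l i < r j => h'.ne⟩
      · exact ⟨(by linarith : l i < l j).ne, (by linarith : r i < r j).ne,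
          (by linarith : l i < r j).ne⟩
      · exact ⟨(by linarith : l j < l i).ne', (by linarith : r j < r i).ne', h.ne'⟩
    rintro (i | i) (j | j) h <;> by_cases hij : i = j
    · rw [hij]
    · exact absurd h (key i j hij).1
    · subst hij
      exact absurd h (hlr i).ne
    · exact absurd h (key i j hij).2.2
    · subst hij
      exact absurd h (hlr i).ne'
    · exact absurd h.symm (key j i (Ne.symm hij)).2.2
    · rw [hij]
    · exact absurd h (key i j hij).2.1
  obtain ⟨π, hπ⟩ := exists_equiv_fin_of_injective _ hinj (k := 2 * n)
    (by rw [Fintype.card_sum, Fintype.card_fin, two_mul])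
  exact ⟨π, fun i => (hπ _ _).2 (hlr i), fun i j hij => by
    simpa only [NestedAt, hπ, Sum.elim_inl, Sum.elim_inr] using hn i j hij⟩

end Nesting

/-! ### Signs -/

section Signs

/-- The sign of `a - b` for `a ≠ b`. -/
def orderSign {α : Type*} [LinearOrder α] (a b : α) : SignType := if b < a then 1 else -1

theorem orderSign_ne_zero {α : Type*} [LinearOrder α] (a b : α) : orderSign a b ≠ 0 := by
  unfold orderSign
  split_ifs <;> decide

theorem SignType.mul_self_of_ne_zero {s : SignType} (h : s ≠ 0) : s * s = 1 := by
  revert h s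
  decide

theorem SignType.prod_ne_zero {ι : Type*} {s : Finset ι} {f : ι → SignType}
    (h : ∀ i ∈ s, f i ≠ 0) : ∏ i ∈ s, f i ≠ 0 :=
  Finset.prod_induction f (· ≠ 0) (by decide) (by decide) h

theorem SignType.prod_ite_neg_one {ι : Type*} (s : Finset ι) (p : ι → Prop) [DecidablePred p] :
    ∏ i ∈ s, (if p i then (-1 : SignType) else 1) = if Even (s.filter p).card then 1 else -1 := by
  rw [Finset.prod_ite, Finset.prod_const, Finset.prod_const_one, mul_one]
  split_ifs with h
  · obtain ⟨k, hk⟩ := h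
    rw [hk, pow_add, ← mul_pow, show (-1 : SignType) * -1 = 1 from rfl, one_pow]
  · obtain ⟨k, hk⟩ := Nat.not_even_iff_odd.1 h
    rw [hk, pow_succ, pow_mul, show (-1 : SignType) ^ 2 = 1 from rfl, one_pow, one_mul]

/-- The element of the complementary pair of `i` that belongs to `complementarySet v`. -/
def pick {n : ℕ} (v : Finset (Fin n)) (i : Fin n) : Fin n ⊕ Fin n :=
  if i ∈ v then .inr i else .inl i

variable {n : ℕ} {G : Digraph (Fin n)} {π : Fin n ⊕ Fin n ≃ Fin (2 * n)}

open Classical in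
-- Compared with the two opening parentheses, moving `j` to its closing parenthesis passes the point
-- of `i` exactly when the pair of `i` is nested in that of `j`, whichever point of `i` is picked;
-- likewise with the roles exchanged.
theorem IsNesting.orderSign_pick (h : IsNesting G π) (v : Finset (Fin n)) {i j : Fin n}
    (hij : i ≠ j) :
    orderSign (π (pick v i)) (π (pick v j)) = orderSign (π (.inl i)) (π (.inl j)) *
      (if j ∈ v ∧ G.Adj j i then -1 else 1) * (if i ∈ v ∧ G.Adj i j then -1 else 1) := by
  have hi := h.lt i
  have hj := h.lt j
  rcases h.nested i j hij with ⟨g, g', h1, h2⟩ | ⟨g, g', h1, h2⟩ | ⟨g, g', h1 | h1⟩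
  all_goals
    dsimp only at *
  · have e1 : ¬ π (.inl j) < π (.inl i) := by order
    have e2 : ¬ π (.inr j) < π (.inl i) := by order
    have e3 : π (.inl j) < π (.inr i) := by order
    by_cases hiv : i ∈ v <;> by_cases hjv : j ∈ v <;> simp [orderSign, pick, *]
  · have e2 : ¬ π (.inr j) < π (.inl i) := by order
    have e3 : π (.inl j) < π (.inr i) := by order
    have e4 : ¬ π (.inr j) < π (.inr i) := by order
    by_cases hiv : i ∈ v <;> by_cases hjv : j ∈ v <;> simp [orderSign, pick, *]
  · have e1 : ¬ π (.inl j) < π (.inl i) := by order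
    have e2 : ¬ π (.inr j) < π (.inl i) := by order
    have e3 : ¬ π (.inl j) < π (.inr i) := by order
    have e4 : ¬ π (.inr j) < π (.inr i) := by order
    by_cases hiv : i ∈ v <;> by_cases hjv : j ∈ v <;> simp [orderSign, pick, *]
  · have e1 : π (.inl j) < π (.inl i) := by order
    have e3 : π (.inl j) < π (.inr i) := by order
    have e4 : π (.inr j) < π (.inr i) := by order
    by_cases hiv : i ∈ v <;> by_cases hjv : j ∈ v <;> simp [orderSign, pick, *]

open Classical in
/-- The sign with which the point on the moment curve belonging to an element is multiplied. -/
noncomputable def elementSign (G : Digraph (Fin n)) (π : Fin n ⊕ Fin n ≃ Fin (2 * n)) :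
    Fin n ⊕ Fin n → SignType :=
  Sum.elim (fun i => -∏ j ∈ Finset.univ.erase i, orderSign (π (.inl i)) (π (.inl j)))
    fun i => (∏ j ∈ Finset.univ.erase i, orderSign (π (.inl i)) (π (.inl j))) *
      ∏ j ∈ Finset.univ.erase i, if G.Adj i j then -1 else 1

theorem elementSign_ne_zero (e : Fin n ⊕ Fin n) : elementSign G π e ≠ 0 := by
  have h1 : ∀ i, ∏ j ∈ Finset.univ.erase i, orderSign (π (.inl i)) (π (.inl j)) ≠ 0 :=
    fun i => SignType.prod_ne_zero fun j _ => orderSign_ne_zero _ _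
  rcases e with i | i
  · have := h1 i
    simp only [elementSign, Sum.elim_inl]
    revert this
    generalize ∏ j ∈ Finset.univ.erase i, orderSign (π (.inl i)) (π (.inl j)) = s
    revert s
    decide
  · refine mul_ne_zero (h1 i) (SignType.prod_ne_zero fun j _ => ?_)
    split_ifs <;> decide

open Classical in
theorem elementSign_inr (i : Fin n) : elementSign G π (.inr i) = elementSign G π (.inl i) *
    if Even ((Finset.univ.erase i).filter fun j => G.Adj i j).card then -1 else 1 := by
  simp only [elementSign, Sum.elim_inl, Sum.elim_inr, SignType.prod_ite_neg_one]
  generalize ∏ j ∈ Finset.univ.erase i, orderSign (π (.inl i)) (π (.inl j)) = s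
  split_ifs <;> revert s <;> decide

open Classical in
-- The identity for which `elementSign` is chosen: it cancels the signs among the opening
-- parentheses and, if `i ∈ v`, the changes caused by the move of `i` itself. What survives is one
-- change for each proper predecessor of `i` in `v`.
theorem IsNesting.elementSign_mul_prod (h : IsNesting G π) (v : Finset (Fin n)) (i : Fin n) :
    elementSign G π (pick v i) *
      ∏ j ∈ Finset.univ.erase i, orderSign (π (pick v i)) (π (pick v j)) =
    (if i ∈ v then 1 else -1) *
      ∏ j ∈ Finset.univ.erase i, if j ∈ v ∧ G.Adj j i then -1 else 1 := by
  rw [Finset.prod_congr rfl fun j hj => h.orderSign_pick v (Finset.ne_of_mem_erase hj).symm,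
    Finset.prod_mul_distrib, Finset.prod_mul_distrib]
  have h1 : ∏ j ∈ Finset.univ.erase i, orderSign (π (.inl i)) (π (.inl j)) ≠ 0 :=
    SignType.prod_ne_zero fun j _ => orderSign_ne_zero _ _
  have h2 : (∏ j ∈ Finset.univ.erase i, if G.Adj i j then (-1 : SignType) else 1) ≠ 0 :=
    SignType.prod_ne_zero fun j _ => by split_ifs <;> decide
  generalize (∏ j ∈ Finset.univ.erase i, if j ∈ v ∧ G.Adj j i then (-1 : SignType) else 1) = c
  by_cases hi : i ∈ v
  · simp only [elementSign, pick, hi, if_true, true_and, Sum.elim_inr]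
    revert h1 h2
    generalize ∏ j ∈ Finset.univ.erase i, orderSign (π (.inl i)) (π (.inl j)) = a
    generalize (∏ j ∈ Finset.univ.erase i, if G.Adj i j then (-1 : SignType) else 1) = b
    revert a b c
    decide
  · simp only [elementSign, pick, hi, if_false, false_and, Sum.elim_inl, Finset.prod_const_one]
    revert h1
    generalize ∏ j ∈ Finset.univ.erase i, orderSign (π (.inl i)) (π (.inl j)) = a
    revert a c
    decide

/-- This is the sign condition on P-matroids. In `elementSign_mul_prod` for `v.erase i` and `insert
i v` the leading signs are opposite, and the opposite signs of the differences within the pair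
compensate for this. -/
theorem IsNesting.elementSign_mul_prod_pair (h : IsNesting G π) (v : Finset (Fin n)) (i : Fin n) :
    elementSign G π (.inl i) * (orderSign (π (.inl i)) (π (.inr i)) *
      ∏ j ∈ Finset.univ.erase i, orderSign (π (.inl i)) (π (pick v j))) =
    elementSign G π (.inr i) * (orderSign (π (.inr i)) (π (.inl i)) *
      ∏ j ∈ Finset.univ.erase i, orderSign (π (.inr i)) (π (pick v j))) := by
  classical
  have h1 := h.elementSign_mul_prod (v.erase i) i
  have h2 := h.elementSign_mul_prod (insert i v) i
  have p1 : ∀ j ∈ Finset.univ.erase i, pick (v.erase i) j = pick v j := fun j hj => by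
    simp [pick, Finset.ne_of_mem_erase hj]
  have p2 : ∀ j ∈ Finset.univ.erase i, pick (insert i v) j = pick v j := fun j hj => by
    simp [pick, Finset.ne_of_mem_erase hj]
  have q1 : ∀ j ∈ Finset.univ.erase i, (if j ∈ v.erase i ∧ G.Adj j i then (-1 : SignType) else 1) =
      if j ∈ v ∧ G.Adj j i then -1 else 1 := fun j hj => by
    simp [Finset.ne_of_mem_erase hj]
  have q2 : ∀ j ∈ Finset.univ.erase i,
      (if j ∈ insert i v ∧ G.Adj j i then (-1 : SignType) else 1) =
      if j ∈ v ∧ G.Adj j i then -1 else 1 := fun j hj => by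
    simp [Finset.ne_of_mem_erase hj]
  have r1 : pick (v.erase i) i = .inl i := by simp [pick]
  have r2 : pick (insert i v) i = .inr i := by simp [pick]
  rw [Finset.prod_congr rfl q1, Finset.prod_congr rfl fun j hj => by rw [p1 j hj], r1,
    if_neg (Finset.notMem_erase i v)] at h1
  rw [Finset.prod_congr rfl q2, Finset.prod_congr rfl fun j hj => by rw [p2 j hj], r2,
    if_pos (Finset.mem_insert_self i v)] at h2
  have s1 : orderSign (π (.inl i)) (π (.inr i)) = -1 := if_neg (h.lt i).not_gt
  have s2 : orderSign (π (.inr i)) (π (.inl i)) = 1 := if_pos (h.lt i)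
  rw [s1, s2, one_mul, h2, mul_left_comm, h1]
  generalize (∏ j ∈ Finset.univ.erase i, if j ∈ v ∧ G.Adj j i then (-1 : SignType) else 1) = c
  revert c
  decide

/-- The extra `-1` is the contribution of `q`, the last point. It turns the leading sign into the
factor of the loop at `i`, which completes the count of all elements of `v` that influence `i`. -/
theorem IsNesting.elementSign_mul_prod_eq_neg_one_iff (h : IsNesting G π)
    {m : Finset (Fin n) → Finset (Fin n)} (hm : IsMatousek G m) (v : Finset (Fin n)) (i : Fin n) :
    elementSign G π (pick v i) *
      (-1 * ∏ j ∈ Finset.univ.erase i, orderSign (π (pick v i)) (π (pick v j))) = -1 ↔ i ∈ m v := by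
  classical
  have h1 : (v.filter fun d => G.Adj d i) =
      Finset.univ.filter fun d => d ∈ v ∧ G.Adj d i := by
    ext
    simp
  have h2 := Finset.mul_prod_erase Finset.univ
    (fun j => if j ∈ v ∧ G.Adj j i then (-1 : SignType) else 1) (Finset.mem_univ i)
  rw [SignType.prod_ite_neg_one Finset.univ, ← h1] at h2
  have h3 := h.elementSign_mul_prod v i
  rw [mul_left_comm, h3, hm.mem_iff_odd, ← Nat.not_even_iff_odd]
  simp only [hm.1.1 i, and_true] at h2
  revert h2
  generalize (∏ j ∈ Finset.univ.erase i, if j ∈ v ∧ G.Adj j i then (-1 : SignType) else 1) = c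
  by_cases hi : i ∈ v <;> split_ifs with hc <;>
    simp only [hc, iff_true, iff_false, not_true, not_false_iff] <;>
    revert c <;> decide

/-! ### Cyclic pairs -/

/-- The elements with negative sign. -/
noncomputable def negativeElements (G : Digraph (Fin n)) (π : Fin n ⊕ Fin n ≃ Fin (2 * n)) :
    Finset (Fin n ⊕ Fin n) :=
  Finset.univ.filter fun e => elementSign G π e = -1

theorem mem_negativeElements {e : Fin n ⊕ Fin n} :
    e ∈ negativeElements G π ↔ elementSign G π e = -1 := by
  simp [negativeElements]

open Classical in
-- Between the two parentheses of `i` lie precisely both parentheses of each proper successor of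
-- `i`.
theorem IsNesting.val_inr (h : IsNesting G π) (i : Fin n) :
    (π (.inr i) : ℕ) =
      π (.inl i) + 2 * ((Finset.univ.erase i).filter fun j => G.Adj i j).card + 1 := by
  set K := (Finset.univ.erase i).filter fun j => G.Adj i j with hK
  have h1 : (K.disjSum K).map π.toEmbedding = Finset.Ioo (π (.inl i)) (π (.inr i)) := by
    ext u
    obtain ⟨e, rfl⟩ := π.surjective u
    rw [Finset.mem_map_equiv, π.symm_apply_apply, Finset.mem_Ioo]
    have hi := h.lt i
    rcases e with j | j <;>
    · simp only [Finset.inl_mem_disjSum, Finset.inr_mem_disjSum, hK, Finset.mem_filter,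
        Finset.mem_erase, Finset.mem_univ, and_true]
      by_cases hij : j = i
      · subst hij
        simp
      have hj := h.lt j
      rcases h.nested i j (Ne.symm hij) with ⟨g, g', h1, h2⟩ | ⟨g, g', h1, h2⟩ | ⟨g, g', h1 | h1⟩
      all_goals
        dsimp only at *
        simp only [ne_eq, hij, not_false_iff, g, g', and_true, and_false, true_iff, false_iff,
          not_and, not_lt]
      all_goals first
        | exact ⟨by order, by order⟩
        | exact fun _ => by order
  have h2 := congrArg Finset.card h1
  rw [Finset.card_map, Finset.card_disjSum, Fin.card_Ioo] at h2
  have := Fin.lt_def.1 (h.lt i)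
  omega

/-- Balance is the nesting property; the parity condition holds because `val_inr` and
`elementSign_inr` involve the same number of proper successors. -/
theorem IsNesting.isCyclicPPair (h : IsNesting G π) :
    IsCyclicPPair π (negativeElements G π) := by
  classical
  constructor
  · rintro (i | i) f he
    · have hi := h.lt i
      have key : ∀ j, π (.inl j) ∈ Set.Icc (π (.inl i)) (π (.inr i)) ↔
          π (.inr j) ∈ Set.Icc (π (.inl i)) (π (.inr i)) := by
        intro j
        by_cases hij : i = j
        · subst hij
          simp [hi.le]
        have hj := h.lt j
        simp only [Set.mem_Icc]
        rcases h.nested i j hij with ⟨-, -, h1, h2⟩ | ⟨-, -, h1, h2⟩ | ⟨-, -, h1 | h1⟩ <;>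
          dsimp only at *
        · exact ⟨fun _ => ⟨by order, by order⟩, fun _ => ⟨by order, by order⟩⟩
        all_goals
          constructor <;> rintro ⟨h3, h4⟩ <;> exfalso <;> order
      rcases f with j | j
      · exact key j
      · exact (key j).symm
    · exact absurd he (h.lt i).not_gt
  · have key : ∀ i, if Even ((|((π (.inl i) : ℕ) : ℤ) - ((π (.inr i) : ℕ) : ℤ)| - 1) / 2) then
        Xor (.inl i ∈ negativeElements G π) (.inr i ∈ negativeElements G π)
        else (.inl i ∈ negativeElements G π ↔ .inr i ∈ negativeElements G π) := by
      intro i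
      have h1 := h.val_inr i
      have h2 := elementSign_inr (G := G) (π := π) i
      have h0 := elementSign_ne_zero (G := G) (π := π) (.inl i)
      revert h1 h2
      generalize ((Finset.univ.erase i).filter fun j => G.Adj i j).card = k
      intro h1 h2
      have h3 : (|((π (.inl i) : ℕ) : ℤ) - ((π (.inr i) : ℕ) : ℤ)| - 1) / 2 = (k : ℤ) := by
        rw [abs_of_nonpos (by omega)]
        omega
      rw [h3]
      simp only [Int.even_coe_nat, mem_negativeElements, h2]
      revert h0
      generalize elementSign G π (.inl i) = s
      split_ifs <;> revert s <;> (try unfold Xor) <;> decide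
    rintro (i | i)
    · exact key i
    · have := key i
      rw [abs_sub_comm, _root_.xor_comm, iff_comm (a := .inl i ∈ negativeElements G π)] at this
      exact this

end Signs

/-! ### The oriented matroid of a real matrix -/

section OfMatrix

variable {r E : Type*} [Fintype E]

/-- A nonzero linear dependency of the columns with inclusion-minimal support. -/
def IsMinimalDependency (V : Matrix r E ℝ) (x : E → ℝ) : Prop :=
  x ≠ 0 ∧ V *ᵥ x = 0 ∧
    ¬ ∃ x' : E → ℝ, x' ≠ 0 ∧ V *ᵥ x' = 0 ∧ Function.support x' ⊂ Function.support x

/-- The sign vectors of the minimal dependencies. -/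
def circuitSet (V : Matrix r E ℝ) : Set (E → SignType) :=
  {X | ∃ x, IsMinimalDependency V x ∧ X = fun e => SignType.sign (x e)}

theorem OrientedMatroid.isRealizedBy_iff {M : OrientedMatroid E} {V : Matrix r E ℝ} :
    M.IsRealizedBy V ↔ M.circuits = circuitSet V := by
  unfold OrientedMatroid.IsRealizedBy circuitSet IsMinimalDependency
  simp only [and_assoc]

theorem support_sign {α : Type*} (x : α → ℝ) :
    Function.support (fun e => SignType.sign (x e)) = Function.support x := by
  ext e
  simp

theorem circuitSet_eq_of_ker_eq {r' : Type*} {V : Matrix r E ℝ} {V' : Matrix r' E ℝ}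
    (h : ∀ x, V *ᵥ x = 0 ↔ V' *ᵥ x = 0) : circuitSet V = circuitSet V' := by
  simp only [circuitSet, IsMinimalDependency, h]

theorem neg_mem_circuitSet {V : Matrix r E ℝ} {X : E → SignType} (hX : X ∈ circuitSet V) :
    -X ∈ circuitSet V := by
  obtain ⟨x, ⟨h0, hV, hmin⟩, rfl⟩ := hX
  refine ⟨-x, ⟨neg_ne_zero.2 h0, by rw [mulVec_neg, hV, neg_zero], ?_⟩, ?_⟩
  · rwa [Function.support_neg]
  · funext e
    simp [Left.sign_neg]

/-- The supports agree by minimality of `y`, and the multiple of `y` that cancels one coordinate of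
`x` must then cancel all of `x`. -/
theorem IsMinimalDependency.exists_smul_eq {V : Matrix r E ℝ} {x y : E → ℝ}
    (hx : IsMinimalDependency V x) (hy : IsMinimalDependency V y)
    (h : Function.support x ⊆ Function.support y) : ∃ c : ℝ, c ≠ 0 ∧ x = c • y := by
  obtain ⟨e, he⟩ := Function.ne_iff.1 hx.1
  have hye : y e ≠ 0 := h he
  have hsub : Function.support y ⊆ Function.support x := by
    by_contra h'
    exact hy.2.2 ⟨x, hx.1, hx.2.1, h, h'⟩
  refine ⟨x e / y e, div_ne_zero he hye, ?_⟩
  by_contra hne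
  refine hx.2.2 ⟨x - (x e / y e) • y, sub_ne_zero.2 hne, ?_, ?_, fun h' => ?_⟩
  · rw [mulVec_sub, mulVec_smul, hx.2.1, hy.2.1, smul_zero, sub_zero]
  · intro f hf
    by_contra hf'
    have h1 : x f = 0 := by simpa using hf'
    have h2 : y f = 0 := by simpa using fun h'' => hf' (hsub h'')
    simp [h1, h2] at hf
  · have := h' he
    simp [hye] at this

/-- Induction on the support: if `z` is not minimal, a multiple of a dependency with smaller support
can be subtracted that kills a coordinate and reverses no sign. -/
theorem exists_conformal_minimalDependency {V : Matrix r E ℝ} (z : E → ℝ) (hz : z ≠ 0)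
    (hV : V *ᵥ z = 0) :
    ∃ x, IsMinimalDependency V x ∧ ∀ f, (0 < x f → 0 < z f) ∧ (x f < 0 → z f < 0) := by
  induction hk : (Function.support z).ncard using Nat.strong_induction_on generalizing z with
  | _ k ih =>
  by_cases hmin : ∃ x' : E → ℝ, x' ≠ 0 ∧ V *ᵥ x' = 0 ∧ Function.support x' ⊂ Function.support z
  swap
  · exact ⟨z, ⟨hz, hV, hmin⟩, fun f => ⟨id, id⟩⟩
  obtain ⟨x, hxV, hsupp, e, he⟩ : ∃ x : E → ℝ, V *ᵥ x = 0 ∧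
      Function.support x ⊂ Function.support z ∧ ∃ e, 0 < x e * z e := by
    obtain ⟨x, hx0, hxV, hsupp⟩ := hmin
    obtain ⟨e, he⟩ := Function.ne_iff.1 hx0
    have hze : z e ≠ 0 := hsupp.1 he
    rcases (mul_ne_zero he hze).lt_or_gt with h | h
    · exact ⟨-x, by rw [mulVec_neg, hxV, neg_zero], by rwa [Function.support_neg], e,
        by rw [Pi.neg_apply]; linarith⟩
    · exact ⟨x, hxV, hsupp, e, h⟩
  -- Among the coordinates where `x` and `z` agree in sign, `e₀` is one that first reaches zero in
  -- `z - t x` as `t` grows.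
  obtain ⟨e₀, he₀, hratio⟩ := Set.exists_min_image {e | 0 < x e * z e} (fun e => z e / x e)
    (Set.toFinite _) ⟨e, he⟩
  have hxe : x e₀ ≠ 0 := left_ne_zero_of_mul (ne_of_gt he₀)
  have hze : z e₀ ≠ 0 := right_ne_zero_of_mul (ne_of_gt he₀)
  set t := z e₀ / x e₀ with ht
  have htpos : 0 < t := by
    have : t = x e₀ * z e₀ / x e₀ ^ 2 := by
      rw [ht]
      field_simp
    rw [this]
    exact div_pos he₀ (by positivity)
  have hzero : ∀ f, z f = 0 → x f = 0 := fun f hf => by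
    by_contra h
    exact hsupp.1 h hf
  have hconf : ∀ f, (0 < z f → 0 ≤ z f - t * x f) ∧ (z f < 0 → z f - t * x f ≤ 0) := by
    refine fun f => ⟨fun hf => ?_, fun hf => ?_⟩
    · rcases le_or_gt (x f) 0 with h | h
      · nlinarith
      · have h1 := hratio f (mul_pos h hf)
        rw [le_div_iff₀ h] at h1
        linarith
    · rcases le_or_gt 0 (x f) with h | h
      · nlinarith
      · have h1 := hratio f (mul_pos_of_neg_of_neg h hf)
        rw [le_div_iff_of_neg h] at h1
        linarith
  have hz' : ∀ f, z f = 0 → z f - t * x f = 0 := fun f hf => by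
    rw [hf, hzero f hf, mul_zero, sub_zero]
  -- At `g` only `z` is nonzero, so `z - t x` does not vanish altogether.
  obtain ⟨g, hg, hgx⟩ := Set.exists_of_ssubset hsupp
  obtain ⟨y, hy, hyc⟩ := ih (Function.support (z - t • x)).ncard (by
      rw [← hk]
      refine Set.ncard_lt_ncard ⟨fun f hf => ?_, fun h => ?_⟩ (Set.toFinite _)
      · exact fun h => hf (hz' f h)
      · have := h hze
        simp [ht, hxe] at this) (z - t • x) (by
      intro h
      have := congrFun h g
      have h0 : x g = 0 := by simpa using hgx
      simp [h0] at this
      exact hg this) (by rw [mulVec_sub, mulVec_smul, hV, hxV, smul_zero, sub_zero]) rfl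
  refine ⟨y, hy, fun f => ⟨fun hf => ?_, fun hf => ?_⟩⟩
  · have h1 : 0 < z f - t * x f := (hyc f).1 hf
    by_contra h2
    rcases (not_lt.1 h2).lt_or_eq with h3 | h3
    · exact absurd ((hconf f).2 h3) (not_le.2 h1)
    · exact h1.ne' (hz' f h3)
  · have h1 : z f - t * x f < 0 := (hyc f).2 hf
    by_contra h2
    rcases (not_lt.1 h2).lt_or_eq with h3 | h3
    · exact absurd ((hconf f).1 h3) (not_le.2 h1)
    · exact h1.ne (hz' f h3.symm)

/-- The oriented matroid realized by a real matrix. -/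
def OrientedMatroid.ofMatrix (V : Matrix r E ℝ) : OrientedMatroid E where
  circuits := circuitSet V
  zero_notMem := by
    rintro ⟨x, hx, h⟩
    refine hx.1 (funext fun e => ?_)
    simpa using (congrFun h e).symm
  neg_mem X hX := neg_mem_circuitSet hX
  incomparable := by
    rintro _ ⟨x, hx, rfl⟩ _ ⟨y, hy, rfl⟩ h
    rw [support_sign, support_sign] at h
    obtain ⟨c, hc, rfl⟩ := hx.exists_smul_eq hy h
    rcases hc.lt_or_gt with hc | hc
    · refine .inr (funext fun e => ?_)
      simp [sign_mul, sign_neg hc]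
    · refine .inl (funext fun e => ?_)
      simp [sign_mul, sign_pos hc]
  elimination := by
    rintro _ ⟨x, hx, rfl⟩ _ ⟨y, hy, rfl⟩ hne e hxe hye
    rw [sign_eq_one_iff] at hxe
    rw [sign_eq_neg_one_iff] at hye
    -- Both coefficients are positive, so each sign of the combination occurs in `x` or in `y`,
    -- while `e` cancels. It can vanish only if the two sign vectors are opposite.
    have hz : -y e • x + x e • y ≠ 0 := by
      intro h0
      refine hne (funext fun f => ?_)
      have h1 : -y e * x f + x e * y f = 0 := congrFun h0 f
      have h2 : x f = (x e / y e) * y f := by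
        rw [div_mul_eq_mul_div, eq_div_iff hye.ne]
        linarith
      have h3 : SignType.sign (x e / y e) = -1 := sign_neg (div_neg_of_pos_of_neg hxe hye)
      rw [Pi.neg_apply, h2, sign_mul, h3, neg_one_mul]
    obtain ⟨z, hz, hzc⟩ := exists_conformal_minimalDependency _ hz (by
      rw [mulVec_add, mulVec_smul, mulVec_smul, hx.2.1, hy.2.1, smul_zero, smul_zero, add_zero])
    refine ⟨_, ⟨z, hz, rfl⟩, ?_, fun f hf => ?_, fun f hf => ?_⟩
    · have h1 : (-y e • x + x e • y) e = 0 := by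
        simp only [Pi.add_apply, Pi.smul_apply, smul_eq_mul]
        ring
      rw [sign_eq_zero_iff]
      by_contra h0
      rcases lt_or_gt_of_ne h0 with h | h
      · exact absurd ((hzc e).2 h) (by rw [h1]; exact lt_irrefl 0)
      · exact absurd ((hzc e).1 h) (by rw [h1]; exact lt_irrefl 0)
    · simp only [sign_eq_one_iff] at hf ⊢
      have h1 : 0 < -y e * x f + x e * y f := (hzc f).1 hf
      by_contra! h2
      nlinarith [h2.1, h2.2]
    · simp only [sign_eq_neg_one_iff] at hf ⊢
      have h1 : -y e * x f + x e * y f < 0 := (hzc f).2 hf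
      by_contra! h2
      nlinarith [h2.1, h2.2]

end OfMatrix

/-! ### Points on the moment curve -/

section Moment

variable {E : Type*}

/-- The matrix whose columns are multiples of points on the moment curve. -/
def scaledMoment (r : ℕ) (ε p : E → ℝ) : Matrix (Fin r) E ℝ :=
  Matrix.of fun i e => ε e * p e ^ (i : ℕ)

variable [DecidableEq E]

/-- The coefficients of the divided difference at the points of `T`. -/
noncomputable def divDiff (ε p : E → ℝ) (T : Finset E) (e : E) : ℝ :=
  if e ∈ T then (ε e)⁻¹ * ∏ u ∈ T.erase e, (p e - p u)⁻¹ else 0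

variable {r : ℕ} {ε p : E → ℝ} {T : Finset E}

theorem divDiff_ne_zero_iff (hp : Function.Injective p) (hε : ∀ e, ε e ≠ 0) {e : E} :
    divDiff ε p T e ≠ 0 ↔ e ∈ T := by
  unfold divDiff
  split_ifs with h
  · simp only [h, iff_true]
    exact mul_ne_zero (inv_ne_zero (hε e)) (Finset.prod_ne_zero_iff.2 fun u hu =>
      inv_ne_zero (sub_ne_zero.2 fun h' => Finset.ne_of_mem_erase hu (hp h').symm))
  · simp [h]

theorem support_divDiff (hp : Function.Injective p) (hε : ∀ e, ε e ≠ 0) :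
    Function.support (divDiff ε p T) = T := by
  ext e
  exact divDiff_ne_zero_iff hp hε

theorem divDiff_map {E' : Type*} [DecidableEq E'] (g : E' ↪ E) (T : Finset E') (e : E') :
    divDiff ε p (T.map g) (g e) = divDiff (ε ∘ g) (p ∘ g) T e := by
  simp only [divDiff, Finset.mem_map', Function.comp_apply]
  rw [← Finset.map_erase, Finset.prod_map]

theorem sign_divDiff {e : E} (he : e ∈ T) :
    SignType.sign (divDiff ε p T e) =
      SignType.sign (ε e) * ∏ u ∈ T.erase e, SignType.sign (p e - p u) := by
  have h : ∀ a : ℝ, SignType.sign a⁻¹ = SignType.sign a := by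
    intro a
    rcases lt_trichotomy a 0 with h | rfl | h
    · rw [sign_neg h, sign_neg (inv_lt_zero.2 h)]
    · simp
    · rw [sign_pos h, sign_pos (inv_pos.2 h)]
  have h2 := map_prod (signHom (α := ℝ)) (fun u => (p e - p u)⁻¹) (T.erase e)
  simp only [signHom_apply, h] at h2
  rw [divDiff, if_pos he, sign_mul, h, h2]

variable [Fintype E]

/-- A divided difference at `r + 1` points kills polynomials of degree below `r`: it is the
coefficient of degree `r` in Lagrange interpolation. -/
theorem scaledMoment_mulVec_divDiff (hp : Function.Injective p) (hε : ∀ e, ε e ≠ 0)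
    (hT : T.card = r + 1) : scaledMoment r ε p *ᵥ divDiff ε p T = 0 := by
  funext i
  have h := Lagrange.coeff_eq_sum (s := T) (v := p) (P := (Polynomial.X ^ (i : ℕ) : Polynomial ℝ))
    hp.injOn (by
      rw [Polynomial.degree_X_pow, hT]
      exact_mod_cast i.2.trans (Nat.lt_succ_self r))
  rw [hT, Nat.add_sub_cancel, Polynomial.coeff_X_pow, if_neg i.2.ne'] at h
  rw [Pi.zero_apply, h, mulVec, dotProduct, ← Finset.sum_subset (Finset.subset_univ T)
    fun e _ he => by rw [divDiff, if_neg he, mul_zero]]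
  refine Finset.sum_congr rfl fun e he => ?_
  rw [divDiff, if_pos he, scaledMoment, of_apply, Polynomial.eval_pow, Polynomial.eval_X,
    Finset.prod_inv_distrib]
  field_simp [hε e]

/-- Vandermonde: at most `r` distinct points on the moment curve are independent. -/
theorem eq_zero_of_scaledMoment_mulVec (hp : Function.Injective p) (hε : ∀ e, ε e ≠ 0)
    (hT : T.card ≤ r) {y : E → ℝ} (hy : scaledMoment r ε p *ᵥ y = 0) (hyT : ∀ e ∉ T, y e = 0) :
    y = 0 := by
  have h := Matrix.eq_zero_of_forall_pow_sum_mul_pow_eq_zero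
    (f := fun j : Fin T.card => p (T.equivFin.symm j))
    (v := fun j => ε (T.equivFin.symm j) * y (T.equivFin.symm j))
    (fun a b hab => by
      simpa [Subtype.ext_iff] using T.equivFin.symm.injective (Subtype.ext (hp hab)))
    (fun i => by
      have h1 := congrFun hy ⟨i, i.2.trans_le hT⟩
      rw [mulVec, dotProduct, ← Finset.sum_subset (Finset.subset_univ T)
        fun e _ he => by rw [hyT e he, mul_zero], ← Finset.sum_coe_sort,
        ← Equiv.sum_comp T.equivFin.symm] at h1
      simp only [scaledMoment, of_apply, Pi.zero_apply] at h1
      rw [← h1]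
      refine Finset.sum_congr rfl fun j _ => by ring)
  funext e
  by_cases he : e ∈ T
  · have h1 := congrFun h (T.equivFin ⟨e, he⟩)
    simpa [hε e] using h1
  · exact hyT e he

theorem exists_eq_smul_divDiff (hp : Function.Injective p) (hε : ∀ e, ε e ≠ 0)
    (hT : T.card = r + 1) {y : E → ℝ} (hy : scaledMoment r ε p *ᵥ y = 0)
    (hyT : ∀ e ∉ T, y e = 0) : ∃ c : ℝ, y = c • divDiff ε p T := by
  obtain ⟨e, he⟩ := Finset.card_pos.1 (by omega : 0 < T.card)
  have h0 := (divDiff_ne_zero_iff hp hε).2 he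
  refine ⟨y e / divDiff ε p T e, sub_eq_zero.1 (eq_zero_of_scaledMoment_mulVec (r := r) (T := T.erase e)
    hp hε ?_ ?_ fun f hf => ?_)⟩
  · rw [Finset.card_erase_of_mem he, hT, Nat.add_sub_cancel]
  · rw [mulVec_sub, mulVec_smul, hy, scaledMoment_mulVec_divDiff hp hε hT, smul_zero, sub_zero]
  · by_cases hfe : f = e
    · subst hfe
      simp [h0]
    · have hfT : f ∉ T := fun h => hf (Finset.mem_erase.2 ⟨hfe, h⟩)
      simp [hyT f hfT, divDiff, hfT]

theorem isMinimalDependency_divDiff (hp : Function.Injective p) (hε : ∀ e, ε e ≠ 0)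
    (hT : T.card = r + 1) : IsMinimalDependency (scaledMoment r ε p) (divDiff ε p T) := by
  refine ⟨fun h => ?_, scaledMoment_mulVec_divDiff hp hε hT, ?_⟩
  · obtain ⟨e, he⟩ := Finset.card_pos.1 (by omega : 0 < T.card)
    exact (divDiff_ne_zero_iff hp hε).2 he (congrFun h e)
  · rintro ⟨y, hy0, hy, hsub⟩
    rw [support_divDiff hp hε] at hsub
    obtain ⟨e, he, hey⟩ := Set.exists_of_ssubset hsub
    refine hy0 (eq_zero_of_scaledMoment_mulVec (T := T.erase e) hp hε ?_ hy fun f hf => ?_)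
    · rw [Finset.card_erase_of_mem he, hT, Nat.add_sub_cancel]
    · by_contra hf0
      exact hf (Finset.mem_erase.2 ⟨fun h => hey (h ▸ hf0), hsub.1 hf0⟩)

/-- The matroid is uniform: every dependency has at least `r + 1` nonzero coordinates, and any `r +
1` columns carry a divided difference, unique up to scaling. -/
theorem mem_circuitSet_scaledMoment (hp : Function.Injective p) (hε : ∀ e, ε e ≠ 0)
    {X : E → SignType} : X ∈ circuitSet (scaledMoment r ε p) ↔
      ∃ T : Finset E, T.card = r + 1 ∧ ((X = fun e => SignType.sign (divDiff ε p T e)) ∨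
        X = -fun e => SignType.sign (divDiff ε p T e)) := by
  constructor
  · rintro ⟨x, hx, rfl⟩
    have hcard : r + 1 ≤ (Finset.univ.filter fun e => x e ≠ 0).card := by
      by_contra! h
      exact hx.1 (eq_zero_of_scaledMoment_mulVec hp hε (Nat.lt_succ_iff.1 h) hx.2.1
        fun e he => by simpa using he)
    obtain ⟨T, hTx, hT⟩ := Finset.exists_subset_card_eq hcard
    obtain ⟨c, hc, h⟩ := (isMinimalDependency_divDiff hp hε hT).exists_smul_eq hx (by
      rw [support_divDiff hp hε]
      exact fun e he => (Finset.mem_filter.1 (hTx he)).2)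
    refine ⟨T, hT, ?_⟩
    rw [h]
    rcases hc.lt_or_gt with hc | hc
    · refine .inr (funext fun e => ?_)
      simp [sign_mul, sign_neg hc]
    · refine .inl (funext fun e => ?_)
      simp [sign_mul, sign_pos hc]
  · have h : ∀ T : Finset E, T.card = r + 1 →
        (fun e => SignType.sign (divDiff ε p T e)) ∈ circuitSet (scaledMoment r ε p) :=
      fun T hT => ⟨_, isMinimalDependency_divDiff hp hε hT, rfl⟩
    rintro ⟨T, hT, rfl | rfl⟩
    · exact h T hT
    · exact neg_mem_circuitSet (h T hT)

end Moment

/-! ### Alternating matroids: dependence on the order only, reorientation, deletion -/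

section

theorem sign_sub_of_strictMono {k : ℕ} {x : Fin k → ℝ} (hx : StrictMono x) {a b : Fin k}
    (h : a ≠ b) : SignType.sign (x a - x b) = orderSign a b := by
  unfold orderSign
  split_ifs with hab
  · exact sign_pos (sub_pos.2 (hx hab))
  · exact sign_neg (sub_neg.2 (hx (lt_of_le_of_ne (not_lt.1 hab) h)))

variable {E : Type*} [Fintype E] [DecidableEq E] {r k : ℕ}

omit [Fintype E] in
theorem sign_divDiff_comp {x : Fin k → ℝ} (hx : StrictMono x) (π : E ≃ Fin k) (ε : E → ℝ)
    {T : Finset E} {e : E} (he : e ∈ T) : SignType.sign (divDiff ε (x ∘ π) T e) =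
      SignType.sign (ε e) * ∏ u ∈ T.erase e, orderSign (π e) (π u) := by
  rw [sign_divDiff he]
  congr 1
  exact Finset.prod_congr rfl fun u hu =>
    sign_sub_of_strictMono hx fun h => Finset.ne_of_mem_erase hu (π.injective h).symm

/-- Signs of divided differences depend on the parameters only through their order, so all
increasing choices realize the same matroid. -/
theorem circuitSet_scaledMoment_eq {x x' : Fin k → ℝ} (hx : StrictMono x) (hx' : StrictMono x')
    (π : E ≃ Fin k) {ε : E → ℝ} (hε : ∀ e, ε e ≠ 0) :
    circuitSet (scaledMoment r ε (x ∘ π)) = circuitSet (scaledMoment r ε (x' ∘ π)) := by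
  ext X
  rw [mem_circuitSet_scaledMoment (hx.injective.comp π.injective) hε,
    mem_circuitSet_scaledMoment (hx'.injective.comp π.injective) hε]
  have h : ∀ T : Finset E, (fun e => SignType.sign (divDiff ε (x ∘ π) T e)) =
      fun e => SignType.sign (divDiff ε (x' ∘ π) T e) := by
    refine fun T => funext fun e => ?_
    by_cases he : e ∈ T
    · rw [sign_divDiff_comp hx π ε he, sign_divDiff_comp hx' π ε he]
    · simp [divDiff, he]
  simp only [h]

theorem momentMatrix_eq_scaledMoment (x : Fin k → ℝ) : momentMatrix r x = scaledMoment r 1 x := by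
  ext i j
  simp [momentMatrix, scaledMoment]

/-- The scaling factors `-1` on `F` and `1` elsewhere. -/
def scaling (F : Finset E) (e : E) : ℝ := if e ∈ F then -1 else 1

omit [Fintype E] in
theorem scaling_ne_zero (F : Finset E) (e : E) : scaling F e ≠ 0 := by
  unfold scaling
  split_ifs <;> norm_num

theorem isAlternating_reorient_relabel {x : Fin k → ℝ} (hx : StrictMono x) (π : E ≃ Fin k)
    (F : Finset E) {M : OrientedMatroid E}
    (hM : M.circuits = circuitSet (scaledMoment r (scaling F) (x ∘ π))) :
    ((M.reorient F).relabel π).IsAlternating r := by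
  refine ⟨x, hx, OrientedMatroid.isRealizedBy_iff.2 ?_⟩
  rw [momentMatrix_eq_scaledMoment]
  ext X
  change flipSigns F (X ∘ π) ∈ M.circuits ↔ _
  rw [hM, mem_circuitSet_scaledMoment (hx.injective.comp π.injective) (scaling_ne_zero F),
    mem_circuitSet_scaledMoment (ε := 1) hx.injective (fun _ => one_ne_zero)]
  have key : ∀ T : Finset E, flipSigns F (fun e => SignType.sign (divDiff (scaling F) (x ∘ π) T e)) =
      (fun e => SignType.sign (divDiff 1 x (T.map π.toEmbedding) e)) ∘ π := by
    refine fun T => funext fun e => ?_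
    have h1 := divDiff_map (ε := (1 : Fin k → ℝ)) (p := x) π.toEmbedding T e
    simp only [Function.comp_apply, Equiv.coe_toEmbedding] at h1 ⊢
    rw [h1]
    by_cases he : e ∈ F <;> by_cases heT : e ∈ T <;>
      simp [flipSigns, divDiff, scaling, he, heT, Left.sign_neg, inv_neg]
  have hinj := Function.LeftInverse.injective (flipSigns_flipSigns F)
  have h3 : ∀ Y : Fin k → SignType, X ∘ π = Y ∘ π ↔ X = Y := fun Y =>
    (π.surjective.injective_comp_right).eq_iff
  have h4 : ∀ T : Finset E, (flipSigns F (X ∘ π) =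
      fun e => SignType.sign (divDiff (scaling F) (x ∘ π) T e)) ↔
      X = fun e => SignType.sign (divDiff 1 x (T.map π.toEmbedding) e) := fun T => by
    rw [← hinj.eq_iff, flipSigns_flipSigns, key, h3]
  have h5 : ∀ T : Finset E, (flipSigns F (X ∘ π) =
      -fun e => SignType.sign (divDiff (scaling F) (x ∘ π) T e)) ↔
      X = -fun e => SignType.sign (divDiff 1 x (T.map π.toEmbedding) e) := fun T => by
    rw [← hinj.eq_iff, flipSigns_flipSigns, flipSigns_neg, key, ← h3]
    rfl
  simp only [h4, h5]
  constructor
  · rintro ⟨T, hT, h⟩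
    exact ⟨T.map π.toEmbedding, by rw [Finset.card_map, hT], h⟩
  · rintro ⟨T, hT, h⟩
    refine ⟨T.map π.symm.toEmbedding, by rw [Finset.card_map, hT], ?_⟩
    have : (T.map π.symm.toEmbedding).map π.toEmbedding = T := by
      ext
      simp
    rwa [this]

/-- The divided differences that vanish at `none` are those of point sets avoiding it, and these are
unaffected by its deletion. -/
theorem circuitSet_comp_some {ε p : Option E → ℝ} (hp : Function.Injective p)
    (hε : ∀ e, ε e ≠ 0) : circuitSet (scaledMoment r (ε ∘ some) (p ∘ some)) =
      {X | (fun e : Option E => e.elim 0 X) ∈ circuitSet (scaledMoment r ε p)} := by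
  ext X
  rw [Set.mem_ofPred_eq, mem_circuitSet_scaledMoment hp hε, mem_circuitSet_scaledMoment
    (ε := ε ∘ some) (hp.comp (Option.some_injective E)) fun e => hε _]
  have key : ∀ T : Finset E, (fun e : Option E => e.elim 0 fun e =>
      SignType.sign (divDiff (ε ∘ some) (p ∘ some) T e)) =
      fun e => SignType.sign (divDiff ε p (T.map Function.Embedding.some) e) := by
    refine fun T => funext fun e => ?_
    cases e with
    | none => simp [divDiff]
    | some e => exact congrArg SignType.sign (divDiff_map Function.Embedding.some T e).symm
  constructor
  · rintro ⟨T, hT, rfl | rfl⟩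
    · exact ⟨T.map Function.Embedding.some, by rw [Finset.card_map, hT], .inl (key T)⟩
    · refine ⟨T.map Function.Embedding.some, by rw [Finset.card_map, hT], .inr ?_⟩
      rw [← key]
      funext e
      cases e <;> rfl
  · rintro ⟨T, hT, h⟩
    have hnone : none ∉ T := by
      rw [← divDiff_ne_zero_iff hp hε (T := T), not_not, ← sign_eq_zero_iff]
      rcases h with h | h
      · exact (congrFun h none).symm
      · have h' : (0 : SignType) = -SignType.sign (divDiff ε p T none) := congrFun h none
        revert h'
        generalize SignType.sign (divDiff ε p T none) = s
        revert s
        decide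
    have hT' : (Finset.eraseNone T).map Function.Embedding.some = T := by
      rw [Finset.map_some_eraseNone, Finset.erase_eq_of_notMem hnone]
    refine ⟨Finset.eraseNone T, by rw [← hT, ← hT', Finset.card_map, hT'], ?_⟩
    rw [← hT', ← key] at h
    refine h.imp (fun h => funext fun e => congrFun h (some e)) fun h =>
      funext fun e => congrFun h (some e)

theorem isBasis_of_circuits_eq {ε p : E → ℝ} (hp : Function.Injective p) (hε : ∀ e, ε e ≠ 0)
    {M : OrientedMatroid E} (hM : M.circuits = circuitSet (scaledMoment r ε p)) {B : Finset E}
    (hB : B.card = r) : M.IsBasis (B : Set E) := by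
  constructor
  · intro X hX hsub
    rw [hM, mem_circuitSet_scaledMoment hp hε] at hX
    obtain ⟨T, hT, h⟩ := hX
    have hsupp : Function.support X = T := by
      rw [← support_divDiff hp hε (T := T), ← support_sign (divDiff ε p T)]
      rcases h with rfl | rfl
      · rfl
      · ext e
        simp
    rw [hsupp, Finset.coe_subset] at hsub
    have := Finset.card_le_card hsub
    omega
  · intro I hI hBI e he
    by_contra heB
    refine hI (fun f => SignType.sign (divDiff ε p (insert e B) f)) ?_ ?_
    · rw [hM, mem_circuitSet_scaledMoment hp hε]
      exact ⟨insert e B, by rw [Finset.card_insert_of_notMem heB, hB], .inl rfl⟩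
    · rw [support_sign, support_divDiff hp hε, Finset.coe_insert]
      exact Set.insert_subset he hBI

end

/-! ### Almost complementary circuits and the P-matroid property -/

section PMatroid

variable {n : ℕ} {G : Digraph (Fin n)} {π : Fin n ⊕ Fin n ≃ Fin (2 * n)}

theorem pick_injective (v : Finset (Fin n)) : Function.Injective (pick v) := by
  intro i j h
  unfold pick at h
  split_ifs at h <;> simpa using h

theorem range_pick (v : Finset (Fin n)) : Set.range (pick v) = complementarySet v := by
  ext (i | i)
  · constructor
    · rintro ⟨j, hj⟩
      unfold pick at hj
      split_ifs at hj with h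
      rw [Sum.inl.injEq] at hj
      exact hj ▸ h
    · intro h
      exact ⟨i, if_neg h⟩
  · constructor
    · rintro ⟨j, hj⟩
      unfold pick at hj
      split_ifs at hj with h
      rw [Sum.inr.injEq] at hj
      exact hj ▸ h
    · intro h
      exact ⟨i, if_pos h⟩

/-- `pick v` as an embedding. -/
def pickEmb (v : Finset (Fin n)) : Fin n ↪ Fin n ⊕ Fin n := ⟨pick v, pick_injective v⟩

theorem pick_ne_of_ne {v : Finset (Fin n)} {i j : Fin n} (h : j ≠ i) :
    pick v j ≠ .inl i ∧ pick v j ≠ .inr i := by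
  unfold pick
  split_ifs <;> simp [h]

theorem sign_scaling_negativeElements (e : Fin n ⊕ Fin n) :
    SignType.sign (scaling (negativeElements G π) e) = elementSign G π e := by
  have h := elementSign_ne_zero (G := G) (π := π) e
  unfold scaling
  split_ifs with h' <;> rw [mem_negativeElements] at h'
  · simp [h']
  · rw [sign_one]
    revert h h'
    generalize elementSign G π e = s
    revert s
    decide

/-- The complementary set of `v` together with both elements of the pair of `i`. -/
def almostComplementary (v : Finset (Fin n)) (i : Fin n) : Finset (Fin n ⊕ Fin n) :=
  insert (.inl i) (insert (.inr i) ((Finset.univ.erase i).map (pickEmb v)))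

theorem inl_notMem_map_pickEmb (v : Finset (Fin n)) (i : Fin n) :
    .inl i ∉ (Finset.univ.erase i).map (pickEmb v) := by
  rw [Finset.mem_map]
  rintro ⟨j, hj, h⟩
  exact (pick_ne_of_ne (Finset.ne_of_mem_erase hj)).1 h

theorem inr_notMem_map_pickEmb (v : Finset (Fin n)) (i : Fin n) :
    .inr i ∉ (Finset.univ.erase i).map (pickEmb v) := by
  rw [Finset.mem_map]
  rintro ⟨j, hj, h⟩
  exact (pick_ne_of_ne (Finset.ne_of_mem_erase hj)).2 h

theorem card_almostComplementary (v : Finset (Fin n)) (i : Fin n) :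
    (almostComplementary v i).card = n + 1 := by
  have hi := inl_notMem_map_pickEmb v i
  have := i.pos
  rw [almostComplementary, Finset.card_insert_of_notMem (by simpa using hi),
    Finset.card_insert_of_notMem (inr_notMem_map_pickEmb v i), Finset.card_map,
    Finset.card_erase_of_mem (Finset.mem_univ i), Finset.card_univ, Fintype.card_fin]
  omega

theorem IsNesting.sign_divDiff_pair (h : IsNesting G π) {x : Fin (2 * n) → ℝ} (hx : StrictMono x)
    (v : Finset (Fin n)) (i : Fin n) :
    SignType.sign (divDiff (scaling (negativeElements G π)) (x ∘ π) (almostComplementary v i)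
      (.inl i)) =
    SignType.sign (divDiff (scaling (negativeElements G π)) (x ∘ π) (almostComplementary v i)
      (.inr i)) := by
  have hl := inl_notMem_map_pickEmb v i
  have hr := inr_notMem_map_pickEmb v i
  have e1 : (almostComplementary v i).erase (.inl i) =
      insert (.inr i) ((Finset.univ.erase i).map (pickEmb v)) :=
    Finset.erase_insert (by simpa using hl)
  have e2 : (almostComplementary v i).erase (.inr i) =
      insert (.inl i) ((Finset.univ.erase i).map (pickEmb v)) := by
    rw [almostComplementary, Finset.insert_comm]
    exact Finset.erase_insert (by simpa using hr)
  rw [sign_divDiff_comp hx π _ (by simp [almostComplementary]),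
    sign_divDiff_comp hx π _ (by simp [almostComplementary]), sign_scaling_negativeElements,
    sign_scaling_negativeElements, e1, e2, Finset.prod_insert hr, Finset.prod_insert hl,
    Finset.prod_map, Finset.prod_map]
  exact h.elementSign_mul_prod_pair v i

theorem IsNesting.isPMatroid (h : IsNesting G π) {x : Fin (2 * n) → ℝ} (hx : StrictMono x)
    {M : OrientedMatroid (Fin n ⊕ Fin n)}
    (hM : M.circuits = circuitSet (scaledMoment n (scaling (negativeElements G π)) (x ∘ π))) :
    M.IsPMatroid := by
  have hp : Function.Injective (x ∘ π) := hx.injective.comp π.injective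
  have hε := scaling_ne_zero (negativeElements G π)
  constructor
  · intro v
    have := isBasis_of_circuits_eq hp hε hM (B := Finset.univ.map (pickEmb v)) (by simp)
    rwa [Finset.coe_map, Finset.coe_univ, Set.image_univ,
      show Set.range (pickEmb v) = complementarySet v from range_pick v] at this
  · intro X hX i hi
    rw [hM, mem_circuitSet_scaledMoment hp hε] at hX
    obtain ⟨T, hT, hX⟩ := hX
    have hXT : ∀ e, X e ≠ 0 ↔ e ∈ T := by
      intro e
      rw [← divDiff_ne_zero_iff hp hε (T := T)]
      rcases hX with rfl | rfl <;> simp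
    simp only [hXT] at hi
    obtain ⟨hl, hr⟩ := (hi i).2 rfl
    -- Apart from the pair of `i`, `T` has at most one element of each pair; as it has `n + 1`
    -- elements, it has exactly one.
    have hsub : T ⊆ almostComplementary (Finset.univ.filter fun j => .inr j ∈ T) i := by
      intro e he
      simp only [almostComplementary, Finset.mem_insert, Finset.mem_map, Finset.mem_erase,
        Finset.mem_univ, and_true]
      rcases e with j | j <;> by_cases hji : j = i
      · exact .inl (by rw [hji])
      · refine .inr (.inr ⟨j, hji, if_neg ?_⟩)
        simpa using fun h => hji ((hi j).1 ⟨he, h⟩)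
      · exact .inr (.inl (by rw [hji]))
      · exact .inr (.inr ⟨j, hji, if_pos (by simpa using he)⟩)
    have hTeq := Finset.eq_of_subset_of_card_le hsub (by rw [card_almostComplementary, hT])
    have key := h.sign_divDiff_pair hx (Finset.univ.filter fun j => .inr j ∈ T) i
    rw [← hTeq] at key
    rcases hX with rfl | rfl
    · exact key
    · exact congrArg Neg.neg key

end PMatroid

/-! ### P-matrices from the determinants of complementary bases -/

section PMatrix

variable {n : ℕ}

/-- The columns of the elements of `complementarySet v`. -/
def baseMatrix (U : Matrix (Fin n) (Fin n ⊕ Fin n) ℝ) (v : Finset (Fin n)) :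
    Matrix (Fin n) (Fin n) ℝ :=
  Matrix.of fun i j => U i (pick v j)

theorem pick_insert_self (v : Finset (Fin n)) (d : Fin n) : pick (insert d v) d = .inr d := by
  simp [pick]

theorem pick_insert_of_ne (v : Finset (Fin n)) {d j : Fin n} (h : j ≠ d) :
    pick (insert d v) j = pick v j := by
  simp [pick, h]

theorem mulVec_eq_sum_of_almostComplementary (U : Matrix (Fin n) (Fin n ⊕ Fin n) ℝ)
    {v : Finset (Fin n)} {d : Fin n} (hd : d ∉ v) {y : Fin n ⊕ Fin n → ℝ}
    (hy : ∀ e ∉ almostComplementary v d, y e = 0) (i : Fin n) :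
    (U *ᵥ y) i = U i (.inr d) * y (.inr d) + ∑ j, baseMatrix U v i j * y (pick v j) := by
  have hl := inl_notMem_map_pickEmb v d
  have hr := inr_notMem_map_pickEmb v d
  rw [mulVec, dotProduct, ← Finset.sum_subset (Finset.subset_univ (almostComplementary v d))
    fun e _ he => by rw [hy e he, mul_zero], almostComplementary,
    Finset.sum_insert (by simpa using hl), Finset.sum_insert hr, Finset.sum_map,
    ← Finset.add_sum_erase _ _ (Finset.mem_univ d)]
  have hp : pick v d = .inl d := if_neg hd
  simp only [baseMatrix, of_apply, hp, pickEmb, Function.Embedding.coeFn_mk]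
  ring

/-- Cramer's rule: `y` expresses a multiple of the column of `inr d` through the columns of
`baseMatrix U v`, which relates the determinants before and after the exchange. -/
theorem det_baseMatrix_insert (U : Matrix (Fin n) (Fin n ⊕ Fin n) ℝ) {v : Finset (Fin n)}
    {d : Fin n} (hd : d ∉ v) {y : Fin n ⊕ Fin n → ℝ} (hU : U *ᵥ y = 0)
    (hy : ∀ e ∉ almostComplementary v d, y e = 0) :
    y (.inr d) * (baseMatrix U (insert d v)).det = -(y (.inl d) * (baseMatrix U v).det) := by
  set A := baseMatrix U v with hA
  set u : Fin n → ℝ := fun j => y (pick v j) with hu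
  have h1 : A *ᵥ u = -y (.inr d) • fun i => U i (.inr d) := by
    funext i
    have h := mulVec_eq_sum_of_almostComplementary U hd hy i
    rw [hU, Pi.zero_apply] at h
    simp only [mulVec, dotProduct, Pi.smul_apply, smul_eq_mul, hu]
    linarith
  have h2 : cramer A (A *ᵥ u) = A.det • u := by
    rw [cramer_eq_adjugate_mulVec, mulVec_mulVec, adjugate_mul, smul_mulVec, one_mulVec]
  have h3 : A.updateCol d (fun i => U i (.inr d)) = baseMatrix U (insert d v) := by
    ext i j
    by_cases hj : j = d
    · subst hj
      simp [baseMatrix, pick_insert_self]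
    · simp [hA, baseMatrix, pick_insert_of_ne, hj]
  have h4 := congrFun h2 d
  rw [h1, map_smul, Pi.smul_apply, cramer_apply, h3] at h4
  have hud : u d = y (.inl d) := by simp [hu, pick, hd]
  rw [Pi.smul_apply, hud, smul_eq_mul, smul_eq_mul] at h4
  linarith

/-- Each exchange of `inl d` for `inr d` reverses the sign of the determinant, because the two
coordinates of `y` have the same sign. -/
theorem neg_one_pow_mul_det_baseMatrix_pos (U : Matrix (Fin n) (Fin n ⊕ Fin n) ℝ)
    (h0 : (baseMatrix U ∅).det ≠ 0)
    (h : ∀ (v : Finset (Fin n)) (d : Fin n), ∃ y : Fin n ⊕ Fin n → ℝ, U *ᵥ y = 0 ∧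
      (∀ e ∉ almostComplementary v d, y e = 0) ∧ 0 < y (.inl d) * y (.inr d))
    (v : Finset (Fin n)) :
    0 < (-1) ^ v.card * ((baseMatrix U ∅).det * (baseMatrix U v).det) := by
  induction v using Finset.induction_on with
  | empty => simpa using h0
  | insert d v hd ih =>
    obtain ⟨y, hU, hy, hpos⟩ := h v d
    have h1 := det_baseMatrix_insert U hd hU hy
    have hr : y (.inr d) ≠ 0 := right_ne_zero_of_mul hpos.ne'
    rw [Finset.card_insert_of_notMem hd]
    -- Multiplying by a square avoids dividing by `y (.inr d)`.
    refine pos_of_mul_pos_right (a := y (.inr d) ^ 2) ?_ (sq_nonneg _)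
    have h2 : y (.inr d) ^ 2 * ((-1) ^ (v.card + 1) *
        ((baseMatrix U ∅).det * (baseMatrix U (insert d v)).det)) =
        (y (.inl d) * y (.inr d)) *
          ((-1) ^ v.card * ((baseMatrix U ∅).det * (baseMatrix U v).det)) := by
      rw [pow_succ]
      linear_combination (-y (.inr d) * (-1) ^ v.card * (baseMatrix U ∅).det) * h1
    rw [h2]
    exact mul_pos hpos ih

/-- The columns outside `s` are unit vectors, so the matrix is block triangular with blocks `-A[s]`
and the identity. -/
theorem det_baseMatrix_fromCols_one (A : Matrix (Fin n) (Fin n) ℝ) (s : Finset (Fin n)) :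
    (baseMatrix (fromCols 1 (-A)) s).det = (-1) ^ s.card *
      (A.submatrix (fun i : s => (i : Fin n)) (fun i : s => (i : Fin n))).det := by
  rw [twoBlockTriangular_det' _ (· ∈ s)]
  · have h1 : toSquareBlockProp (baseMatrix (fromCols 1 (-A)) s) (fun i => ¬ i ∈ s) = 1 := by
      ext ⟨i, hi⟩ ⟨j, hj⟩
      simp [toSquareBlockProp, baseMatrix, pick, hj, Matrix.one_apply]
    have h2 : toSquareBlockProp (baseMatrix (fromCols 1 (-A)) s) (· ∈ s) =
        -A.submatrix (fun i : s => (i : Fin n)) (fun i : s => (i : Fin n)) := by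
      ext ⟨i, hi⟩ ⟨j, hj⟩
      simp [toSquareBlockProp, baseMatrix, pick, hj]
    rw [h1, det_one, mul_one, h2, ← Fintype.card_coe s]
    convert det_neg (A.submatrix (fun i : s => (i : Fin n)) (fun i : s => (i : Fin n))) using 2
  · intro i hi j hj
    have : i ≠ j := fun h => hj (h ▸ hi)
    simp [baseMatrix, pick, hj, this]

/-- Multiplication by the inverse of `baseMatrix U ∅` reduces to `fromCols 1 (-M)`, so each
principal minor is, up to `(-1) ^ s.card`, a quotient of two base determinants. -/
theorem isPMatrix_of_det_baseMatrix (U : Matrix (Fin n) (Fin n ⊕ Fin n) ℝ)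
    (h : ∀ v, 0 < (-1) ^ v.card * ((baseMatrix U ∅).det * (baseMatrix U v).det)) :
    IsPMatrix (-((baseMatrix U ∅)⁻¹ * of fun i j => U i (.inr j))) := by
  intro s
  have h0 : (baseMatrix U ∅).det ≠ 0 := fun h0 => by simpa [h0] using h ∅
  set S := baseMatrix U ∅ with hS
  have hSinv : S⁻¹ * S = 1 := nonsing_inv_mul _ (isUnit_iff_ne_zero.2 h0)
  have h1 : S⁻¹ * baseMatrix U s =
      baseMatrix (fromCols 1 (- -(S⁻¹ * of fun i j => U i (.inr j)))) s := by
    ext i j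
    by_cases hj : j ∈ s
    · simp [baseMatrix, pick, hj, Matrix.mul_apply]
    · have := congrFun (congrFun hSinv i) j
      simp only [baseMatrix, of_apply, pick, hj, if_false, fromCols_apply_inl, ← this,
        Matrix.mul_apply]
      simp [hS, baseMatrix, pick]
  have h2 := det_baseMatrix_fromCols_one (-(S⁻¹ * of fun i j => U i (.inr j))) s
  rw [← h1, det_mul, det_nonsing_inv, Ring.inverse_eq_inv'] at h2
  have h3 := h s
  have h4 : ((-1 : ℝ) ^ s.card) * (-1) ^ s.card = 1 := by rw [← mul_pow]; norm_num
  set D := ((-(S⁻¹ * of fun i j => U i (.inr j))).submatrix (fun i : s => (i : Fin n))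
    (fun i : s => (i : Fin n))).det
  have h5 : D = (-1) ^ s.card * (S.det * (baseMatrix U s).det) / S.det ^ 2 := by
    rw [eq_div_iff (pow_ne_zero 2 h0)]
    have h6 : (baseMatrix U s).det = S.det * ((-1) ^ s.card * D) := by
      rw [← h2, mul_inv_cancel_left₀ h0]
    rw [h6]
    linear_combination (-D * S.det ^ 2) * h4
  rw [h5]
  positivity

end PMatrix

/-! ### Candidate solutions as linear dependencies -/

section LCP

variable {n : ℕ}

/-- The vector `(w, z, 1)`. -/
def lcpVector (w z : Fin n → ℝ) : Option (Fin n ⊕ Fin n) → ℝ :=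
  fun e => e.elim 1 (Sum.elim w z)

theorem plcpMatrix_mulVec_lcpVector (A : Matrix (Fin n) (Fin n) ℝ) (b w z : Fin n → ℝ) :
    plcpMatrix A b *ᵥ lcpVector w z = w - A *ᵥ z - b := by
  funext i
  have h : ∑ j, (1 : Matrix (Fin n) (Fin n) ℝ) i j * w j = w i := congrFun (one_mulVec w) i
  simp only [mulVec, dotProduct, Fintype.sum_option, Fintype.sum_sum_type, plcpMatrix, of_apply,
    lcpVector, Option.elim_none, Option.elim_some, Sum.elim_inl, Sum.elim_inr, h, Pi.sub_apply,
    neg_mul, Finset.sum_neg_distrib]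
  ring

/-- The P-LCP matrix arises from `V` by invertible row operations; hence it has the same
dependencies and the same circuits. -/
theorem plcpMatrix_eq_mul (V : Matrix (Fin n) (Option (Fin n ⊕ Fin n)) ℝ)
    (hV : IsUnit (colsS V).det) :
    plcpMatrix (-((colsS V)⁻¹ * colsT V)) (-((colsS V)⁻¹ *ᵥ colQ V)) = (colsS V)⁻¹ * V := by
  ext i e
  rcases e with _ | j | j
  · simp [plcpMatrix, colQ, mulVec, dotProduct, Matrix.mul_apply]
  · have h := congrFun (congrFun (nonsing_inv_mul _ hV) i) j
    simp only [plcpMatrix, of_apply, ← h, Matrix.mul_apply]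
    simp [colsS]
  · simp [plcpMatrix, colsT, Matrix.mul_apply]

theorem plcpMatrix_mulVec_eq_zero_iff (V : Matrix (Fin n) (Option (Fin n ⊕ Fin n)) ℝ)
    (hV : IsUnit (colsS V).det) (y : Option (Fin n ⊕ Fin n) → ℝ) :
    plcpMatrix (-((colsS V)⁻¹ * colsT V)) (-((colsS V)⁻¹ *ᵥ colQ V)) *ᵥ y = 0 ↔ V *ᵥ y = 0 := by
  rw [plcpMatrix_eq_mul V hV, ← mulVec_mulVec]
  constructor
  · intro h
    have h1 := congrArg (colsS V *ᵥ ·) h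
    simpa [mulVec_mulVec, ← Matrix.mul_assoc, mul_nonsing_inv _ hV] using h1
  · intro h
    rw [h, mulVec_zero]

/-- `y` is the linear dependency of the columns of `V` that belongs to the fundamental circuit of
`q` with respect to `complementarySet v`. -/
structure IsFundamental (V : Matrix (Fin n) (Option (Fin n ⊕ Fin n)) ℝ) (v : Finset (Fin n))
    (y : Option (Fin n ⊕ Fin n) → ℝ) : Prop where
  mulVec_eq : V *ᵥ y = 0
  none : y none = 1
  ne_zero_iff : ∀ e, y (some e) ≠ 0 ↔ e ∈ complementarySet v
  eq_of : ∀ y', V *ᵥ y' = 0 → y' Option.none = 1 → (∀ e ∉ complementarySet v, y' (some e) = 0) →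
    y' = y

/-- A candidate solution for `B` is the dependency `(w, z, 1)` vanishing off `complementarySet B`,
so it is the fundamental one. Its full support gives non-degeneracy, and since one of `w i`, `z i`
vanishes, membership in the outmap is the negativity of the other. -/
theorem plcpRealizes_of_isFundamental (V : Matrix (Fin n) (Option (Fin n ⊕ Fin n)) ℝ)
    (hV : IsUnit (colsS V).det) (hP : IsPMatrix (-((colsS V)⁻¹ * colsT V)))
    {m : Finset (Fin n) → Finset (Fin n)}
    (h : ∀ v, ∃ y, IsFundamental V v y ∧ ∀ i, y (some (pick v i)) < 0 ↔ i ∈ m v) :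
    PLCPRealizes (-((colsS V)⁻¹ * colsT V)) (-((colsS V)⁻¹ *ᵥ colQ V)) m := by
  have hcand : ∀ w z, w - (-((colsS V)⁻¹ * colsT V)) *ᵥ z = -((colsS V)⁻¹ *ᵥ colQ V) ↔
      V *ᵥ lcpVector w z = 0 := fun w z => by
    rw [← plcpMatrix_mulVec_eq_zero_iff V hV, plcpMatrix_mulVec_lcpVector, sub_eq_zero]
  refine ⟨hP, fun B w z hc i hi => ?_, fun B => ?_⟩
  · obtain ⟨y, hy, -⟩ := h B
    have h1 := hy.eq_of _ ((hcand w z).1 hc.1) rfl (by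
      rintro (j | j) hj
      · exact hc.2.1 j (not_not.1 hj)
      · exact hc.2.2 j hj)
    by_cases hiB : i ∈ B
    · exact (hy.ne_zero_iff (.inr i)).2 hiB (by rw [← h1]; exact hi.2)
    · exact (hy.ne_zero_iff (.inl i)).2 hiB (by rw [← h1]; exact hi.1)
  · obtain ⟨y, hy, hm⟩ := h B
    have hw : ∀ i ∈ B, y (some (.inl i)) = 0 := fun i hi => by
      by_contra h0
      exact (hy.ne_zero_iff _).1 h0 hi
    have hz : ∀ i ∉ B, y (some (.inr i)) = 0 := fun i hi => by
      by_contra h0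
      exact hi ((hy.ne_zero_iff _).1 h0)
    refine ⟨fun i => y (some (.inl i)), fun i => y (some (.inr i)), ⟨?_, hw, hz⟩, fun i => ?_⟩
    · rw [hcand]
      convert hy.mulVec_eq using 2
      funext e
      rcases e with _ | i | i
      · exact hy.none.symm
      · rfl
      · rfl
    · rw [← hm i]
      by_cases hi : i ∈ B
      · have h0 : y (some (.inr i)) ≠ 0 := (hy.ne_zero_iff _).2 hi
        simp only [pick, hi, if_true, hw i hi, le_refl, true_and]
        exact ⟨le_of_lt, fun h => lt_of_le_of_ne h h0⟩
      · have h0 : y (some (.inl i)) ≠ 0 := (hy.ne_zero_iff _).2 hi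
        simp only [pick, hi, if_false, hz i hi, le_refl, and_true]
        exact ⟨le_of_lt, fun h => lt_of_le_of_ne h h0⟩

end LCP

/-! ### The extension by `q` as last point and its fundamental circuits -/

section Extension

variable {n : ℕ} {G : Digraph (Fin n)} {π : Fin n ⊕ Fin n ≃ Fin (2 * n)}

/-- The ordering `π` with `q` as additional last element. -/
def extendOrder (π : Fin n ⊕ Fin n ≃ Fin (2 * n)) :
    Option (Fin n ⊕ Fin n) ≃ Fin (2 * n + 1) :=
  (Equiv.optionCongr π).trans finSuccEquivLast.symm

theorem extendOrder_none : extendOrder π none = Fin.last (2 * n) := by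
  simp [extendOrder]

theorem extendOrder_some (e : Fin n ⊕ Fin n) : extendOrder π (some e) = (π e).castSucc := by
  simp [extendOrder]

theorem restrictOrder_extendOrder : restrictOrder (extendOrder π) = π := by
  have h : (extendOrder π).trans (finSuccEquiv' (extendOrder π none)) = Equiv.optionCongr π := by
    rw [extendOrder_none]
    ext1 e
    simp [extendOrder, finSuccEquivLast]
  rw [restrictOrder, h, Equiv.removeNone_optionCongr]

/-- The reoriented elements of the extended ground set. -/
noncomputable def extendedNegatives (G : Digraph (Fin n)) (π : Fin n ⊕ Fin n ≃ Fin (2 * n)) :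
    Finset (Option (Fin n ⊕ Fin n)) :=
  (negativeElements G π).map Function.Embedding.some

theorem some_mem_extendedNegatives {e : Fin n ⊕ Fin n} :
    some e ∈ extendedNegatives G π ↔ e ∈ negativeElements G π := by
  simp [extendedNegatives]

theorem scaling_extendedNegatives_comp_some :
    scaling (extendedNegatives G π) ∘ some = scaling (negativeElements G π) := by
  funext e
  simp [scaling, some_mem_extendedNegatives]

theorem comp_extendOrder_comp_some (x : Fin (2 * n + 1) → ℝ) :
    (x ∘ extendOrder π) ∘ some = (x ∘ Fin.castSucc) ∘ π := by
  funext e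
  simp [extendOrder_some]

theorem orderSign_castSucc {k : ℕ} (a b : Fin k) :
    orderSign a.castSucc b.castSucc = orderSign a b := by
  simp [orderSign]

theorem signedMomentMatrix_eq (x : Fin (2 * n + 1) → ℝ) :
    signedMomentMatrix (extendOrder π) (extendedNegatives G π) x =
      scaledMoment n (scaling (extendedNegatives G π)) (x ∘ extendOrder π) :=
  rfl

/-- The support of the fundamental circuit of `q` with respect to `complementarySet v`. -/
def fundamentalSupport (v : Finset (Fin n)) : Finset (Option (Fin n ⊕ Fin n)) :=
  insert none ((Finset.univ.map (pickEmb v)).map Function.Embedding.some)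

theorem some_mem_fundamentalSupport {v : Finset (Fin n)} {e : Fin n ⊕ Fin n} :
    some e ∈ fundamentalSupport v ↔ e ∈ complementarySet v := by
  rw [← range_pick]
  simp [fundamentalSupport, pickEmb]

theorem card_fundamentalSupport (v : Finset (Fin n)) : (fundamentalSupport v).card = n + 1 := by
  rw [fundamentalSupport, Finset.card_insert_of_notMem (by simp)]
  simp

theorem pick_mem_complementarySet (v : Finset (Fin n)) (i : Fin n) :
    pick v i ∈ complementarySet v := by
  rw [← range_pick]
  exact ⟨i, rfl⟩

/-- `q` is not negated and exceeds all other points, so every factor is positive. -/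
theorem divDiff_none_pos {x : Fin (2 * n + 1) → ℝ} (hx : StrictMono x) (v : Finset (Fin n)) :
    0 < divDiff (scaling (extendedNegatives G π)) (x ∘ extendOrder π) (fundamentalSupport v)
      none := by
  rw [← sign_eq_one_iff, sign_divDiff_comp hx _ _ (by simp [fundamentalSupport]),
    fundamentalSupport, Finset.erase_insert (by simp), Finset.prod_map]
  simp [scaling, extendedNegatives, orderSign, extendOrder_none, extendOrder_some,
    Fin.castSucc_lt_last]

theorem IsNesting.divDiff_pick_neg_iff (h : IsNesting G π) {m : Finset (Fin n) → Finset (Fin n)}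
    (hm : IsMatousek G m) {x : Fin (2 * n + 1) → ℝ} (hx : StrictMono x) (v : Finset (Fin n))
    (i : Fin n) :
    divDiff (scaling (extendedNegatives G π)) (x ∘ extendOrder π) (fundamentalSupport v)
      (some (pick v i)) < 0 ↔ i ∈ m v := by
  have h1 : (fundamentalSupport v).erase (some (pick v i)) =
      insert none (((Finset.univ.erase i).map (pickEmb v)).map Function.Embedding.some) := by
    rw [fundamentalSupport, Finset.erase_insert_of_ne (by simp), Finset.map_erase,
      Finset.map_erase]
    rfl
  have h2 : SignType.sign (scaling (extendedNegatives G π) (some (pick v i))) =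
      elementSign G π (pick v i) := by
    rw [← sign_scaling_negativeElements, ← scaling_extendedNegatives_comp_some]
    rfl
  have h3 : orderSign (extendOrder π (some (pick v i))) (extendOrder π none) = -1 := by
    rw [extendOrder_none, extendOrder_some]
    exact if_neg (Fin.castSucc_lt_last _).not_gt
  rw [← sign_eq_neg_one_iff, sign_divDiff_comp hx _ _
    (some_mem_fundamentalSupport.2 (pick_mem_complementarySet v i)), h1,
    Finset.prod_insert (by simp), Finset.prod_map, Finset.prod_map, h2, h3,
    ← h.elementSign_mul_prod_eq_neg_one_iff hm v i]
  simp only [Function.Embedding.some_apply, extendOrder_some, orderSign_castSucc, pickEmb,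
    Function.Embedding.coeFn_mk]

theorem IsNesting.exists_isFundamental (h : IsNesting G π)
    {m : Finset (Fin n) → Finset (Fin n)} (hm : IsMatousek G m) {x : Fin (2 * n + 1) → ℝ}
    (hx : StrictMono x) (v : Finset (Fin n)) :
    ∃ y, IsFundamental (signedMomentMatrix (extendOrder π) (extendedNegatives G π) x) v y ∧
      ∀ i, y (some (pick v i)) < 0 ↔ i ∈ m v := by
  have hp : Function.Injective (x ∘ extendOrder π) := hx.injective.comp (extendOrder π).injective
  have hε := scaling_ne_zero (extendedNegatives G π)
  have hpos := divDiff_none_pos (G := G) (π := π) hx v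
  rw [signedMomentMatrix_eq]
  set κ := divDiff (scaling (extendedNegatives G π)) (x ∘ extendOrder π) (fundamentalSupport v)
    with hκ
  -- Normalizing the coordinate of `q` to `1` keeps all signs, since `κ none` is positive.
  refine ⟨(κ none)⁻¹ • κ, ⟨?_, ?_, fun e => ?_, fun y' hy' hq hy'0 => ?_⟩, fun i => ?_⟩
  · rw [mulVec_smul, scaledMoment_mulVec_divDiff hp hε (card_fundamentalSupport v), smul_zero]
  · simp [hpos.ne']
  · rw [← some_mem_fundamentalSupport, ← divDiff_ne_zero_iff hp hε, ← hκ]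
    simp [hpos.ne']
  · obtain ⟨c, rfl⟩ := exists_eq_smul_divDiff hp hε (card_fundamentalSupport v) hy' (by
      rintro (_ | e) he
      · exact absurd (Finset.mem_insert_self _ _) he
      · exact hy'0 e fun h => he (some_mem_fundamentalSupport.2 h))
    rw [Pi.smul_apply, smul_eq_mul, ← hκ] at hq
    rw [eq_inv_of_mul_eq_one_left hq]
  · rw [← h.divDiff_pick_neg_iff hm hx v i, ← hκ, Pi.smul_apply, smul_eq_mul]
    rw [inv_mul_lt_iff₀ hpos, mul_zero]

theorem isAssociatedOrientation_of_divDiff {x : Fin (2 * n + 1) → ℝ} (hx : StrictMono x)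
    (h : IsNesting G π) {m : Finset (Fin n) → Finset (Fin n)} (hm : IsMatousek G m)
    {M' : OrientedMatroid (Option (Fin n ⊕ Fin n))}
    (hM' : M'.circuits = circuitSet (signedMomentMatrix (extendOrder π) (extendedNegatives G π) x)) :
    IsAssociatedOrientation M' m := by
  intro v
  have hp : Function.Injective (x ∘ extendOrder π) := hx.injective.comp (extendOrder π).injective
  have hε := scaling_ne_zero (extendedNegatives G π)
  have hsupp := support_divDiff hp hε (T := fundamentalSupport v)
  refine ⟨_, by
    rw [hM', signedMomentMatrix_eq, mem_circuitSet_scaledMoment hp hε]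
    exact ⟨_, card_fundamentalSupport v, .inl rfl⟩, ?_, ?_, fun i => ?_⟩
  · rw [support_sign, hsupp, ← range_pick]
    ext e
    simp [fundamentalSupport, pickEmb, eq_comm]
  · exact sign_pos (divDiff_none_pos hx v)
  · rw [← h.divDiff_pick_neg_iff hm hx v i]
    have h0 : ∀ e ∉ complementarySet v, divDiff (scaling (extendedNegatives G π))
        (x ∘ extendOrder π) (fundamentalSupport v) (some e) = 0 := fun e he => by
      by_contra h'
      exact he (some_mem_fundamentalSupport.1 ((divDiff_ne_zero_iff hp hε).1 h'))
    by_cases hi : i ∈ v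
    · have := h0 (.inl i) (not_not.2 hi)
      simp [pick, hi, this, sign_eq_neg_one_iff]
    · have := h0 (.inr i) hi
      simp [pick, hi, this, sign_eq_neg_one_iff]

/-- Without `q` the matrix is again a scaled moment matrix: Vandermonde makes `colsS V` invertible,
and the equal signs in `sign_divDiff_pair` drive the exchange argument for the principal minors. -/
theorem IsNesting.isUnit_and_isPMatrix (h : IsNesting G π) {x : Fin (2 * n + 1) → ℝ}
    (hx : StrictMono x) :
    let V := signedMomentMatrix (extendOrder π) (extendedNegatives G π) x
    IsUnit (colsS V).det ∧ IsPMatrix (-((colsS V)⁻¹ * colsT V)) := by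
  intro V
  have hx' : StrictMono (x ∘ Fin.castSucc) := hx.comp Fin.strictMono_castSucc
  have hp : Function.Injective ((x ∘ Fin.castSucc) ∘ π) := hx'.injective.comp π.injective
  have hε := scaling_ne_zero (negativeElements G π)
  set U := scaledMoment n (scaling (negativeElements G π)) ((x ∘ Fin.castSucc) ∘ π) with hU
  have hUV : ∀ i e, V i (some e) = U i e := by
    intro i e
    rw [hU, ← scaling_extendedNegatives_comp_some, ← comp_extendOrder_comp_some]
    rfl
  have hS : colsS V = baseMatrix U ∅ := by
    ext i j
    simp [colsS, baseMatrix, pick, hUV]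
  have hT : colsT V = of fun i j => U i (.inr j) := by
    ext i j
    simp [colsT, hUV]
  have h0 : (baseMatrix U ∅).det ≠ 0 := by
    intro h0
    obtain ⟨u, hu0, hu⟩ := exists_mulVec_eq_zero_iff.2 h0
    have h1 := eq_zero_of_scaledMoment_mulVec (r := n) (T := Finset.univ.map Function.Embedding.inl)
      hp hε (by simp) (y := Sum.elim u 0) (by
        refine Eq.trans ?_ hu
        funext i
        simp [mulVec, dotProduct, Fintype.sum_sum_type, baseMatrix, pick, hU])
      (by
        rintro (e | e) he
        · simp at he
        · rfl)
    exact hu0 (funext fun i => congrFun h1 (.inl i))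
  rw [hS, hT]
  refine ⟨isUnit_iff_ne_zero.2 h0, isPMatrix_of_det_baseMatrix U
    (neg_one_pow_mul_det_baseMatrix_pos U h0 fun v d => ⟨_, scaledMoment_mulVec_divDiff hp hε
      (card_almostComplementary v d), fun e he => if_neg he, ?_⟩)⟩
  have h1 := (divDiff_ne_zero_iff hp hε (T := almostComplementary v d) (e := .inl d)).2
    (Finset.mem_insert_self _ _)
  have h2 := h.sign_divDiff_pair hx' v d
  rw [← sign_eq_one_iff, sign_mul, ← h2]
  exact SignType.mul_self_of_ne_zero (sign_ne_zero.2 h1)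

end Extension

/-! ### The main theorem -/

theorem mainTheorem1 (n : ℕ) (G : Digraph (Fin n)) (m : Finset (Fin n) → Finset (Fin n))
    (hm : IsMatousek G m) :
    IsUSO m ∧
    (IsRealizable m ↔ ¬ ContainsInduced G forbiddenG1 ∧ ¬ ContainsInduced G forbiddenG2) ∧
    ((¬ ContainsInduced G forbiddenG1 ∧ ¬ ContainsInduced G forbiddenG2) ↔
      IsClosureOfBranching G) ∧
    (IsRealizable m →
      ∃ (M' : OrientedMatroid (Option (Fin n ⊕ Fin n))) (M : OrientedMatroid (Fin n ⊕ Fin n))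
        (π : Option (Fin n ⊕ Fin n) ≃ Fin (2 * n + 1)) (F : Finset (Option (Fin n ⊕ Fin n))),
        IsSimpleExtension M' M π F ∧ π none = Fin.last (2 * n) ∧
        IsAssociatedOrientation M' m ∧
        ∀ x : Fin (2 * n + 1) → ℝ, StrictMono x →
          let V := signedMomentMatrix π F x
          let A := -((colsS V)⁻¹ * colsT V)
          let b := -((colsS V)⁻¹ *ᵥ colQ V)
          M'.IsRealizedBy V ∧ IsUnit (colsS V).det ∧
          PLCPRealizes A b m ∧ M'.IsRealizedBy (plcpMatrix A b)) := by
  have hforest : ¬ ContainsInduced G forbiddenG1 ∧ ¬ ContainsInduced G forbiddenG2 →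
      IsForestOrder G := fun h => hm.1.isForestOrder h.1 h.2
  have hreal : ∀ π : Fin n ⊕ Fin n ≃ Fin (2 * n), IsNesting G π →
      ∀ x : Fin (2 * n + 1) → ℝ, StrictMono x →
        let V := signedMomentMatrix (extendOrder π) (extendedNegatives G π) x
        PLCPRealizes (-((colsS V)⁻¹ * colsT V)) (-((colsS V)⁻¹ *ᵥ colQ V)) m :=
    fun π hπ x hx => plcpRealizes_of_isFundamental _ (hπ.isUnit_and_isPMatrix hx).1
      (hπ.isUnit_and_isPMatrix hx).2 (hπ.exists_isFundamental hm hx)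
  have hx₀ : StrictMono fun j : Fin (2 * n + 1) => ((j : ℕ) : ℝ) := fun a b hab =>
    Nat.cast_lt.2 hab
  refine ⟨hm.isUSO, ⟨hm.not_containsInduced_of_isRealizable, fun h => ?_⟩,
    ⟨fun h => (hforest h).isClosureOfBranching, fun h => h.isForestOrder.not_containsInduced⟩,
    fun h => ?_⟩
  · obtain ⟨π, hπ⟩ := (hforest h).exists_isNesting
    exact ⟨_, _, hreal π hπ _ hx₀⟩
  -- The given realization serves only to exclude `G₁` and `G₂`; the cyclic one is built anew from
  -- the nesting.
  obtain ⟨π, hπ⟩ := (hforest (hm.not_containsInduced_of_isRealizable h)).exists_isNesting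
  set x₀ : Fin (2 * n + 1) → ℝ := fun j => ((j : ℕ) : ℝ)
  have hx₀' : StrictMono (x₀ ∘ Fin.castSucc) := hx₀.comp Fin.strictMono_castSucc
  have hF : (Finset.univ.filter fun e => some e ∈ extendedNegatives G π) =
      negativeElements G π := by
    ext e
    simp [some_mem_extendedNegatives]
  refine ⟨.ofMatrix (scaledMoment n (scaling (extendedNegatives G π)) (x₀ ∘ extendOrder π)),
    .ofMatrix (scaledMoment n (scaling (negativeElements G π)) ((x₀ ∘ Fin.castSucc) ∘ π)),
    extendOrder π, extendedNegatives G π,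
    ⟨⟨hπ.isPMatroid hx₀' rfl, π, negativeElements G π,
      isAlternating_reorient_relabel hx₀' π _ rfl⟩, ?_,
      isAlternating_reorient_relabel hx₀ _ _ rfl, ?_⟩, extendOrder_none,
    isAssociatedOrientation_of_divDiff hx₀ hπ hm rfl, fun x hx => ?_⟩
  · have := circuitSet_comp_some (r := n) (hx₀.injective.comp (extendOrder π).injective)
      (scaling_ne_zero (extendedNegatives G π))
    rwa [scaling_extendedNegatives_comp_some, comp_extendOrder_comp_some] at this
  · rw [restrictOrder_extendOrder, hF]
    exact hπ.isCyclicPPair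
  · have hV := (hπ.isUnit_and_isPMatrix hx).1
    -- The matroid was defined with the points `x₀`; its circuits are those of every increasing `x`.
    have hcirc := circuitSet_scaledMoment_eq (r := n) hx₀ hx (extendOrder π)
      (scaling_ne_zero (extendedNegatives G π))
    refine ⟨OrientedMatroid.isRealizedBy_iff.2 hcirc, hV, hreal π hπ x hx,
      OrientedMatroid.isRealizedBy_iff.2 (hcirc.trans ?_)⟩
    exact circuitSet_eq_of_ker_eq fun y => (plcpMatrix_mulVec_eq_zero_iff _ hV y).symm
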